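/- **Setting.** For each index $j\in\mathbb N$ (suppressed in the notation below) let $\mathcal G$ be an undirected simple graph on $n$ nodes with maximum degree $d$ and oriented incidence matrix $F$ (the row of an edge $\{i,i'\}$, $i<i'$, has $-1$ in entry $i$, $+1$ in entry $i'$ and $0$ elsewhere). The graph difference operators are $\Delta^{(1)}=F$ and, for $k\ge 1$, $\Delta^{(k+1)}=F^T\Delta^{(k)}$ if $k$ is odd, $\Delta^{(k+1)}=F\Delta^{(k)}$ if $k$ is even. Consider the linear model $y=X\beta^*+\varepsilon$ with $X\in\mathbb R^{N\times n}$, where $\|\Delta^{(k+1)}\beta^*\|_0\le s_1$ and $\|\beta^*\|_0\le s_2$ for integers $s_1,s_2>0$, $\varepsilon\sim N(0,\sigma_\varepsilon^2I_N)$ with $\sigma_\varepsilon>0$ is independent of $X$, and the rows of $X$ are i.i.d. draws from a mean-zero distribution on $\mathbb R^n$ with covariance matrix $\Sigma_x$ such that $\mathbb E\exp(t\,u^TX_i)\le\exp(\sigma_x^2t^2/2)$ for all $t\in\mathbb R$ and all unit vectors $u$. The eigenvalues of $\Sigma_x$ lie in $[c,c']$ with $0<c\le c'$, and $\Theta_x=\Sigma_x^{-1}$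 satisfies $\max_i\sum_l|(\Theta_x)_{il}|\le M_n$. Below, $\|\cdot\|_\infty$ is the largest absolute entry of a vector or matrix. Put $\Sigma_N=X^TX/N$ and let $$\hat\beta\in\operatorname*{argmin}_{\beta\in\mathbb R^n}\ \tfrac1{2N}\|y-X\beta\|_2^2+\lambda_g\|\Delta^{(k+1)}\beta\|_1+\lambda\|\beta\|_1 .$$ Let $\widehat\Theta$ be a measurable function of $X$ that minimizes $\sum_{i,l}|\Theta_{il}|$ over all $\Theta\in\mathbb R^{n\times n}$ with $\|\Theta\Sigma_N-I_n\|_\infty\le\mu$ whenever this constraint is feasible (and is arbitrary otherwise), and let $\tilde\beta=\hat\beta+\frac1N\widehat\Theta X^T(y-X\hat\beta)$. **Theorem.** Fix $k\ge0$, $0\le\nu<1$, $\sigma_x>0$, $c>0$ and $c'>0$. There are constants $C_0,A,A'>0$, depending only on these, such that the following holds for all constants $B,B'$ and every sequence of such models (in which $N,n,\mathcal G,s_1,s_2,\beta^*,\Sigma_x,M_n,\sigma_\varepsilon$ and the laws may all vary) with $n\to\infty$, $N\ge C_0\,s_2\log n$, $s_2/s_1\ge\nu$, and tuning parameters $$A\,\sigma_\varepsilon\sqrt{\tfrac{\log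 n}N}\le\lambda\le B\,\sigma_\varepsilon\sqrt{\tfrac{\log n}N},\qquad \lambda_g=\lambda\sqrt{\tfrac{\nu}{(2d)^{k+1}}},\qquad A'\sqrt{\tfrac{\log n}N}\le\mu\le B'\sqrt{\tfrac{\log n}N}$$ (with $\lambda_g=0$ if the graph has no edges). We have $\sqrt N(\tilde\beta-\beta^*)=\Psi-e$ with $\Psi=\frac1{\sqrt N}\widehat\Theta X^T\varepsilon$ and $e=\sqrt N(\widehat\Theta\Sigma_N-I_n)(\hat\beta-\beta^*)$, where $$\Psi\mid X\sim N\bigl(0,\ \sigma_\varepsilon^2\,\widehat\Theta\Sigma_N\widehat\Theta^T\bigr),\qquad \|e\|_\infty=\mathcal O_{\mathbb P}\Bigl(\frac{\sigma_\varepsilon s_2\log n}{\sqrt N}\Bigr),$$ and $$\bigl\|\widehat\Theta\Sigma_N\widehat\Theta^T-\Theta_x\bigr\|_\infty=\mathcal O_{\mathbb P}\Bigl(M_n\sqrt{\tfrac{\log n}N}\Bigr).$$ -/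

import Mathlib

open MeasureTheory ProbabilityTheory Filter Matrix
open scoped Topology

namespace GraphPPLasso

/-! ### Matrix and vector norms -/

/-- The Borel (product) measurable structure on the space of real matrices. -/
instance instMeasurableSpaceMatrix {m n : Type*} : MeasurableSpace (Matrix m n ℝ) :=
  inferInstanceAs (MeasurableSpace (m → n → ℝ))

/-- Element-wise infinity norm `‖v‖_∞ = max_i |v_i|` of a vector (`0` if there are no entries). -/
noncomputable def vecSupNorm {ι : Type*} (v : ι → ℝ) : ℝ := ⨆ i, |v i|

/-- Element-wise infinity norm `‖A‖_∞ = max_{i,j} |A_ij|` of a matrix. -/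
noncomputable def matSupNorm {ι κ : Type*} (A : Matrix ι κ ℝ) : ℝ :=
  ⨆ p : ι × κ, |A p.1 p.2|

/-- The `ℓ_∞`-operator norm (maximal absolute row sum) of a matrix. -/
noncomputable def opNormInf {ι κ : Type*} [Fintype κ] (A : Matrix ι κ ℝ) : ℝ :=
  ⨆ i, ∑ j, |A i j|

/-- The element-wise `ℓ_1`-norm `‖A‖_{1,1}` of a matrix. -/
def norm11 {ι κ : Type*} [Fintype ι] [Fintype κ] (A : Matrix ι κ ℝ) : ℝ := ∑ i, ∑ j, |A i j|

/-- The `ℓ_1`-norm of a vector. -/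
def l1Norm {ι : Type*} [Fintype ι] (v : ι → ℝ) : ℝ := ∑ i, |v i|

/-- `‖v‖_0`: the number of non-zero entries of a vector. -/
noncomputable def l0Norm {ι : Type*} (v : ι → ℝ) : ℕ := Set.ncard {i | v i ≠ 0}

/-- All eigenvalues of the symmetric matrix `A` lie in `[lo, hi]`. -/
def SymmEigenvaluesIn {n : ℕ} (lo hi : ℝ) (A : Matrix (Fin n) (Fin n) ℝ) : Prop :=
  ∃ h : A.IsHermitian, ∀ i, lo ≤ h.eigenvalues i ∧ h.eigenvalues i ≤ hi

/-! ### Graph difference operators -/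

section Graph

variable {n : ℕ}

noncomputable instance instFintypeEdges (G : SimpleGraph (Fin n)) : Fintype G.edgeSet :=
  Fintype.ofFinite _

/-- The oriented incidence matrix, with rows indexed by the edges of the graph: the row of the
edge `{i, j}`, `i < j`, has `-1` in the entry `i` and `+1` in the entry `j`. -/
def incidence (G : SimpleGraph (Fin n)) : Matrix G.edgeSet (Fin n) ℝ :=
  Matrix.of fun e v => if v = (e : Sym2 (Fin n)).inf then -1
    else if v = (e : Sym2 (Fin n)).sup then 1 else 0

/-- The index set of the rows of the difference operator of order `k + 1`:
the edges if `k` is even, the nodes if `k` is odd. -/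
def DiffIndex (G : SimpleGraph (Fin n)) : ℕ → Type
  | 0 => G.edgeSet
  | 1 => Fin n
  | k + 2 => DiffIndex G k

noncomputable instance instFintypeDiffIndex (G : SimpleGraph (Fin n)) :
    (k : ℕ) → Fintype (DiffIndex G k)
  | 0 => inferInstanceAs (Fintype G.edgeSet)
  | 1 => inferInstanceAs (Fintype (Fin n))
  | k + 2 => instFintypeDiffIndex G k

/-- The left factor in the recursion from order `k + 1` to order `k + 2`:
`Fᵀ` if `k` is even, `F` if `k` is odd. -/
def diffStep (G : SimpleGraph (Fin n)) :
    (k : ℕ) → Matrix (DiffIndex G (k + 1)) (DiffIndex G k) ℝ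
  | 0 => (incidence G)ᵀ
  | 1 => incidence G
  | k + 2 => diffStep G k

/-- `diffOp G k` is the graph difference operator `Δ^{(k+1)}` of order `k + 1`:
`Δ^{(1)} = F`, and `Δ^{(k+1)} = Fᵀ Δ^{(k)}` for odd `k`, `Δ^{(k+1)} = F Δ^{(k)}` for even `k`. -/
noncomputable def diffOp (G : SimpleGraph (Fin n)) :
    (k : ℕ) → Matrix (DiffIndex G k) (Fin n) ℝ
  | 0 => incidence G
  | k + 1 => diffStep G k * diffOp G k

open Classical in
/-- The maximum degree of the graph. -/
noncomputable def maxDeg (G : SimpleGraph (Fin n)) : ℕ := G.maxDegree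

/-- The parameter space `S(k, s₁, s₂)`. -/
def paramSpace (G : SimpleGraph (Fin n)) (k s₁ s₂ : ℕ) : Set (Fin n → ℝ) :=
  {β | l0Norm (diffOp G k *ᵥ β) ≤ s₁ ∧ l0Norm β ≤ s₂}

end Graph

/-! ### Sub-Gaussian designs -/

/-- A real random variable is `σ`-sub-Gaussian: mean zero, and moment generating function
at most `exp (σ² t² / 2)` for every real `t`. -/
def IsSubGaussian {Ω : Type*} [MeasurableSpace Ω] (σ : ℝ) (Z : Ω → ℝ) (P : Measure Ω) : Prop :=
  ∫ ω, Z ω ∂P = 0 ∧ HasSubgaussianMGF Z ⟨σ ^ 2, sq_nonneg σ⟩ P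

/-- A distribution `Q` on `ℝⁿ` is `σ`-sub-Gaussian: mean zero, and each projection on a unit
vector is `σ`-sub-Gaussian. -/
def IsSubGaussianLaw {n : ℕ} (σ : ℝ) (Q : Measure (Fin n → ℝ)) : Prop :=
  (∀ a, ∫ x, x a ∂Q = 0) ∧
    ∀ u : Fin n → ℝ, u ⬝ᵥ u = 1 → IsSubGaussian σ (fun x => u ⬝ᵥ x) Q

/-- `X` is a row-wise `(σ, S)`-sub-Gaussian random matrix: its rows are i.i.d. draws from a
`σ`-sub-Gaussian distribution with covariance matrix `S`. -/
def IsRowwiseSubGaussian {Ω : Type*} [MeasurableSpace Ω] {N n : ℕ} (P : Measure Ω)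
    (X : Ω → Matrix (Fin N) (Fin n) ℝ) (σ : ℝ) (S : Matrix (Fin n) (Fin n) ℝ) : Prop :=
  ∃ Q : Measure (Fin n → ℝ), IsProbabilityMeasure Q ∧ IsSubGaussianLaw σ Q ∧
    (∀ a b, cov[fun x => x a, fun x => x b; Q] = S a b) ∧
    (∀ i, HasLaw (fun ω => X ω i) Q P) ∧
    iIndepFun (fun i ω => X ω i) P

/-! ### The estimators -/

section Estimators

variable {N n : ℕ}

/-- `Σ_N = Xᵀ X / N`. -/
noncomputable def sampleCov (X : Matrix (Fin N) (Fin n) ℝ) : Matrix (Fin n) (Fin n) ℝ :=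
  (1 / (N : ℝ)) • (Xᵀ * X)

/-- The objective function of the `k`-th order Graph-Piecewise-Polynomial-Lasso. -/
noncomputable def gpplObjective (G : SimpleGraph (Fin n)) (k : ℕ) (lam lamg : ℝ)
    (X : Matrix (Fin N) (Fin n) ℝ) (y : Fin N → ℝ) (β : Fin n → ℝ) : ℝ :=
  1 / (2 * (N : ℝ)) * ∑ i, (y i - (X *ᵥ β) i) ^ 2 + lamg * l1Norm (diffOp G k *ᵥ β)
    + lam * l1Norm β

/-- `β` is a `k`-th order Graph-Piecewise-Polynomial-Lasso estimate for the data `(X, y)`. -/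
def IsGPPLasso (G : SimpleGraph (Fin n)) (k : ℕ) (lam lamg : ℝ)
    (X : Matrix (Fin N) (Fin n) ℝ) (y : Fin N → ℝ) (β : Fin n → ℝ) : Prop :=
  ∀ β', gpplObjective G k lam lamg X y β ≤ gpplObjective G k lam lamg X y β'

/-- `Θ` satisfies the constraint `‖Θ S - I‖_∞ ≤ μ`. -/
def CLIMEFeasible (μ : ℝ) (S Θ : Matrix (Fin n) (Fin n) ℝ) : Prop :=
  matSupNorm (Θ * S - 1) ≤ μ

/-- `Θ` minimizes `‖Θ‖_{1,1}` subject to `‖Θ S - I‖_∞ ≤ μ`. -/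
def IsCLIME (μ : ℝ) (S Θ : Matrix (Fin n) (Fin n) ℝ) : Prop :=
  CLIMEFeasible μ S Θ ∧ ∀ Θ', CLIMEFeasible μ S Θ' → norm11 Θ ≤ norm11 Θ'

/-- `T` is a CLIME estimator with tuning parameter `μ`: a Borel function of the design matrix
whose value is a solution of the CLIME program for `Σ_N` at every design for which the program
has a feasible point (at the other designs, where there is no solution, the value is arbitrary). -/
def IsCLIMEEstimator (μ : ℝ)
    (T : Matrix (Fin N) (Fin n) ℝ → Matrix (Fin n) (Fin n) ℝ) : Prop :=
  Measurable T ∧ ∀ A, (∃ Θ, CLIMEFeasible μ (sampleCov A) Θ) → IsCLIME μ (sampleCov A) (T A)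

/-- The one-step estimator `β̂ + Θ̂ Xᵀ (y - X β̂) / N`. -/
noncomputable def oneStep (X : Matrix (Fin N) (Fin n) ℝ) (y : Fin N → ℝ)
    (Θ : Matrix (Fin n) (Fin n) ℝ) (β : Fin n → ℝ) : Fin n → ℝ :=
  β + (1 / (N : ℝ)) • ((Θ * Xᵀ) *ᵥ (y - X *ᵥ β))

/-- The leading term `Ψ = Θ̂ Xᵀ ε / √N`. -/
noncomputable def leadingTerm (X : Matrix (Fin N) (Fin n) ℝ) (Θ : Matrix (Fin n) (Fin n) ℝ)
    (ε : Fin N → ℝ) : Fin n → ℝ :=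
  (1 / √(N : ℝ)) • ((Θ * Xᵀ) *ᵥ ε)

/-- The remainder `e = √N (Θ̂ Σ_N - I) (β̂ - β*)`. -/
noncomputable def remainderTerm (X : Matrix (Fin N) (Fin n) ℝ) (Θ : Matrix (Fin n) (Fin n) ℝ)
    (β βstar : Fin n → ℝ) : Fin n → ℝ :=
  √(N : ℝ) • ((Θ * sampleCov X - 1) *ᵥ (β - βstar))

end Estimators

/-! ### Stochastic boundedness -/

/-- `Y_j = O_P(a_j)` as `j → ∞`, where `Y_j` lives on the probability space `(Ω_j, P_j)`. -/
def IsBigOInProb {Ω : ℕ → Type*} [∀ j, MeasurableSpace (Ω j)] (P : ∀ j, Measure (Ω j))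
    (Y : ∀ j, Ω j → ℝ) (a : ℕ → ℝ) : Prop :=
  ∀ δ : ℝ, 0 < δ → ∃ K : ℝ, 0 < K ∧
    ∀ᶠ j in atTop, P j {ω | K * a j < |Y j ω|} ≤ ENNReal.ofReal δ

end GraphPPLasso

namespace GraphPPLasso

/-!
Everything happens on one event of probability at least `1 - 8 / n`. On it `Σₓ⁻¹` is feasible for
the CLIME program, the diagonal of `Σ_N` is bounded, `‖Xᵀ ε‖_∞ ≤ N λ / 2`, and the quadratic form
of `Σ_N` is bounded below at every sum of `O(s₂)` signed coordinate vectors. Maurey's averaging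
argument carries the last bound over to all `v` with `‖v‖₁² ≤ 36 s₂ ‖v‖²`, a restricted
eigenvalue condition.

Since `‖Δ^{(k+1)}‖² ≤ (2d)^{k+1}`, the choice of `λ_g` makes the graph penalty of an error `v`
contribute at most `λ √s₂ ‖v‖₂`, so the usual argument for the lasso gives
`‖β̂ - β*‖₁ = O(s₂ λ)` and `‖e‖_∞ ≤ √N μ ‖β̂ - β*‖₁`. The CLIME program splits over the rows, so
each row of `Θ̂` has `ℓ₁`-norm at most that of the row of `Σₓ⁻¹`, hence at most `M_n`; together with
the two feasibility bounds this gives `‖Θ̂ Σ_N Θ̂ᵀ - Σₓ⁻¹‖_∞ ≤ 3 M_n μ`. The conditional law of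
`Ψ` follows by freezing the design.
-/

/-! ### Norms -/

section Norms

variable {ι κ : Type*}

lemma vecSupNorm_nonneg (v : ι → ℝ) : 0 ≤ vecSupNorm v :=
  Real.iSup_nonneg fun _ => abs_nonneg _

lemma matSupNorm_nonneg (A : Matrix ι κ ℝ) : 0 ≤ matSupNorm A :=
  Real.iSup_nonneg fun _ => abs_nonneg _

lemma vecSupNorm_le {v : ι → ℝ} {C : ℝ} (hC : 0 ≤ C) (h : ∀ i, |v i| ≤ C) : vecSupNorm v ≤ C :=
  Real.iSup_le h hC

lemma matSupNorm_le {A : Matrix ι κ ℝ} {C : ℝ} (hC : 0 ≤ C) (h : ∀ i j, |A i j| ≤ C) :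
    matSupNorm A ≤ C :=
  Real.iSup_le (fun p => h p.1 p.2) hC

lemma abs_le_matSupNorm [Finite ι] [Finite κ] (A : Matrix ι κ ℝ) (i : ι) (j : κ) :
    |A i j| ≤ matSupNorm A :=
  le_ciSup (f := fun p : ι × κ => |A p.1 p.2|) (Set.finite_range _).bddAbove (i, j)

lemma l1Norm_row_le_opNormInf [Finite ι] [Fintype κ] (A : Matrix ι κ ℝ) (i : ι) :
    l1Norm (A i) ≤ opNormInf A :=
  le_ciSup (f := fun i => ∑ j, |A i j|) (Set.finite_range _).bddAbove i

lemma opNormInf_nonneg [Fintype κ] (A : Matrix ι κ ℝ) : 0 ≤ opNormInf A :=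
  Real.iSup_nonneg fun _ => Finset.sum_nonneg fun _ _ => abs_nonneg _

variable [Fintype ι]

lemma l1Norm_nonneg (v : ι → ℝ) : 0 ≤ l1Norm v :=
  Finset.sum_nonneg fun _ _ => abs_nonneg _

lemma abs_dotProduct_le_mul_l1Norm {v w : ι → ℝ} {a : ℝ} (h : ∀ i, |v i| ≤ a) :
    |v ⬝ᵥ w| ≤ a * l1Norm w := by
  rw [l1Norm, Finset.mul_sum]
  refine (Finset.abs_sum_le_sum_abs _ _).trans (Finset.sum_le_sum fun i _ => ?_)
  rw [abs_mul]
  exact mul_le_mul_of_nonneg_right (h i) (abs_nonneg _)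

lemma dotProduct_self_nonneg (v : ι → ℝ) : 0 ≤ v ⬝ᵥ v := by
  simpa using dotProduct_self_star_nonneg v

lemma sq_dotProduct_le (v w : ι → ℝ) : (v ⬝ᵥ w) ^ 2 ≤ (v ⬝ᵥ v) * (w ⬝ᵥ w) := by
  simpa only [dotProduct, sq] using Finset.sum_mul_sq_le_sq_mul_sq Finset.univ v w

open Classical in
lemma l1Norm_sub_add_l1Norm_sub_le_sum_support (a b : ι → ℝ) :
    l1Norm a - l1Norm b + l1Norm (b - a) ≤ 2 * ∑ i with a i ≠ 0, |(b - a) i| := by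
  unfold l1Norm
  rw [Finset.sum_filter, Finset.mul_sum, ← Finset.sum_sub_distrib, ← Finset.sum_add_distrib]
  refine Finset.sum_le_sum fun i _ => ?_
  by_cases h : a i = 0
  · simp [h]
  · simp only [ne_eq, h, not_false_eq_true, if_true, Pi.sub_apply]
    have := abs_sub_abs_le_abs_sub (a i) (b i)
    rw [abs_sub_comm] at this
    linarith

open Classical in
lemma sum_support_abs_le_sqrt_l0Norm_mul (a d : ι → ℝ) :
    ∑ i with a i ≠ 0, |d i| ≤ √(l0Norm a) * √(d ⬝ᵥ d) := by
  have hcard : l0Norm a = (Finset.univ.filter fun i => a i ≠ 0).card := by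
    rw [l0Norm, ← Set.ncard_coe_finset, Finset.coe_filter_univ]
  rw [← Real.sqrt_mul (by positivity), hcard]
  refine Real.le_sqrt_of_sq_le ((sq_sum_le_card_mul_sum_sq (f := fun i => |d i|)).trans
    (mul_le_mul_of_nonneg_left ?_ (by positivity)))
  simp only [sq_abs, dotProduct, ← sq]
  exact Finset.sum_le_sum_of_subset_of_nonneg (Finset.filter_subset _ _) fun i _ _ => sq_nonneg _

lemma l1Norm_sub_add_l1Norm_sub_le (a b : ι → ℝ) :
    l1Norm a - l1Norm b + l1Norm (b - a) ≤ 2 * (√(l0Norm a) * √((b - a) ⬝ᵥ (b - a))) :=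
  (l1Norm_sub_add_l1Norm_sub_le_sum_support a b).trans
    (mul_le_mul_of_nonneg_left (sum_support_abs_le_sqrt_l0Norm_mul a _) zero_le_two)

lemma l1Norm_sub_le (a b : ι → ℝ) :
    l1Norm a - l1Norm b ≤ √(l0Norm a) * √((b - a) ⬝ᵥ (b - a)) := by
  have htriangle : l1Norm a - l1Norm b ≤ l1Norm (b - a) := by
    rw [l1Norm, l1Norm, l1Norm, ← Finset.sum_sub_distrib]
    refine Finset.sum_le_sum fun i _ => ?_
    rw [Pi.sub_apply, abs_sub_comm]
    exact abs_sub_abs_le_abs_sub _ _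
  linarith [l1Norm_sub_add_l1Norm_sub_le a b]

lemma dotProduct_self_transpose_mulVec_le [Fintype κ] {A : Matrix ι κ ℝ} {c : ℝ}
    (hc : 0 ≤ c) (h : ∀ v, (A *ᵥ v) ⬝ᵥ (A *ᵥ v) ≤ c * (v ⬝ᵥ v)) (w : ι → ℝ) :
    (Aᵀ *ᵥ w) ⬝ᵥ (Aᵀ *ᵥ w) ≤ c * (w ⬝ᵥ w) := by
  set x := Aᵀ *ᵥ w
  have hadj : x ⬝ᵥ x = w ⬝ᵥ (A *ᵥ x) := by
    rw [dotProduct_mulVec, ← mulVec_transpose, transpose_transpose, dotProduct_comm]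
  have hsq : (x ⬝ᵥ x) * (x ⬝ᵥ x) ≤ c * (w ⬝ᵥ w) * (x ⬝ᵥ x) :=
    calc (x ⬝ᵥ x) * (x ⬝ᵥ x) = (w ⬝ᵥ (A *ᵥ x)) ^ 2 := by rw [hadj, sq]
      _ ≤ (w ⬝ᵥ w) * ((A *ᵥ x) ⬝ᵥ (A *ᵥ x)) := sq_dotProduct_le _ _
      _ ≤ (w ⬝ᵥ w) * (c * (x ⬝ᵥ x)) := by gcongr; exacts [dotProduct_self_nonneg w, h x]
      _ = _ := by ring
  rcases (dotProduct_self_nonneg x).eq_or_lt with h0 | h0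
  · exact h0 ▸ mul_nonneg hc (dotProduct_self_nonneg w)
  · exact le_of_mul_le_mul_right hsq h0

end Norms

/-! ### Operator norm of the graph difference operators -/

section Graph

lemma sum_edgeFinset_sum_toFinset {V M : Type*} [Fintype V] [DecidableEq V] [AddCommMonoid M]
    (G : SimpleGraph V) [Fintype G.edgeSet] [G.LocallyFinite] (f : V → M) :
    ∑ e ∈ G.edgeFinset, ∑ i ∈ e.toFinset, f i = ∑ i, G.degree i • f i := by
  rw [Finset.sum_comm' (s' := fun i => G.incidenceFinset i) (t' := Finset.univ)]
  · simp only [Finset.sum_const, SimpleGraph.card_incidenceFinset_eq_degree]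
  · simp [SimpleGraph.incidenceSet]

lemma sq_sub_le_two_mul_sum_toFinset {V : Type*} [LinearOrder V] (v : V → ℝ) (e : Sym2 V) :
    (v e.sup - v e.inf) ^ 2 ≤ 2 * ∑ i ∈ e.toFinset, v i ^ 2 := by
  induction e using Sym2.ind with
  | _ a b =>
    have hsq := add_sq_le (a := v a) (b := -v b)
    rw [Sym2.sup_mk, Sym2.inf_mk, Sym2.toFinset_mk_eq]
    rcases lt_trichotomy a b with h | rfl | h
    · rw [Finset.sum_pair h.ne, sup_of_le_right h.le, inf_of_le_left h.le]
      nlinarith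
    · rw [sup_idem, inf_idem, sub_self, sq, mul_zero]
      exact mul_nonneg zero_le_two (Finset.sum_nonneg fun i _ => sq_nonneg (v i))
    · rw [Finset.sum_pair h.ne', sup_of_le_left h.le, inf_of_le_right h.le]
      nlinarith

variable {n : ℕ}

lemma incidence_mulVec (G : SimpleGraph (Fin n)) (v : Fin n → ℝ) (e : G.edgeSet) :
    (incidence G *ᵥ v) e = v (e : Sym2 (Fin n)).sup - v (e : Sym2 (Fin n)).inf := by
  have hne : (e : Sym2 (Fin n)).sup ≠ (e : Sym2 (Fin n)).inf := by
    obtain ⟨e, he⟩ := e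
    induction e using Sym2.ind with
    | _ a b => simpa using G.ne_of_adj (G.mem_edgeSet.mp he)
  have hrow : incidence G e = Pi.single (e : Sym2 (Fin n)).sup 1
      - Pi.single (e : Sym2 (Fin n)).inf 1 := by
    ext x
    by_cases hinf : x = (e : Sym2 (Fin n)).inf
    · simp [incidence, hinf, hne.symm]
    · simp [incidence, hinf, Pi.single_apply]
  rw [mulVec, hrow, sub_dotProduct, single_one_dotProduct, single_one_dotProduct]

lemma dotProduct_self_incidence_mulVec_le (G : SimpleGraph (Fin n)) (v : Fin n → ℝ) :
    (incidence G *ᵥ v) ⬝ᵥ (incidence G *ᵥ v) ≤ 2 * (maxDeg G : ℝ) * (v ⬝ᵥ v) := by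
  classical
  have hdeg (i : Fin n) : G.degree i ≤ maxDeg G := by
    unfold maxDeg
    convert G.degree_le_maxDegree i
  calc (incidence G *ᵥ v) ⬝ᵥ (incidence G *ᵥ v)
      = ∑ e : G.edgeSet, (v (e : Sym2 (Fin n)).sup - v (e : Sym2 (Fin n)).inf) ^ 2 := by
        simp only [dotProduct, incidence_mulVec, sq]
    _ = ∑ e ∈ G.edgeFinset, (v e.sup - v e.inf) ^ 2 :=
        (Finset.sum_subtype _ (fun _ => SimpleGraph.mem_edgeFinset)
          fun e : Sym2 (Fin n) => (v e.sup - v e.inf) ^ 2).symm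
    _ ≤ ∑ e ∈ G.edgeFinset, 2 * ∑ i ∈ e.toFinset, v i ^ 2 :=
        Finset.sum_le_sum fun e _ => sq_sub_le_two_mul_sum_toFinset v e
    _ = 2 * ∑ i, (G.degree i : ℝ) * v i ^ 2 := by
        simp only [← Finset.mul_sum, sum_edgeFinset_sum_toFinset, nsmul_eq_mul]
    _ ≤ 2 * ∑ i, (maxDeg G : ℝ) * v i ^ 2 := by
        gcongr with i
        exact hdeg i
    _ = 2 * (maxDeg G : ℝ) * (v ⬝ᵥ v) := by
        simp only [← Finset.mul_sum, mul_assoc, dotProduct, sq]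

lemma dotProduct_self_diffStep_mulVec_le (G : SimpleGraph (Fin n)) : ∀ (k : ℕ)
    (v : DiffIndex G k → ℝ),
    (diffStep G k *ᵥ v) ⬝ᵥ (diffStep G k *ᵥ v) ≤ 2 * (maxDeg G : ℝ) * (v ⬝ᵥ v)
  | 0, v =>
    dotProduct_self_transpose_mulVec_le (by positivity) (dotProduct_self_incidence_mulVec_le G) v
  | 1, v => dotProduct_self_incidence_mulVec_le G v
  | k + 2, v => dotProduct_self_diffStep_mulVec_le G k v

lemma dotProduct_self_diffOp_mulVec_le (G : SimpleGraph (Fin n)) (k : ℕ) (v : Fin n → ℝ) :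
    (diffOp G k *ᵥ v) ⬝ᵥ (diffOp G k *ᵥ v) ≤ (2 * (maxDeg G : ℝ)) ^ (k + 1) * (v ⬝ᵥ v) := by
  induction k with
  | zero =>
    rw [zero_add, pow_one]
    exact dotProduct_self_incidence_mulVec_le G v
  | succ k ih =>
    rw [diffOp, ← mulVec_mulVec, pow_succ', mul_assoc]
    exact (dotProduct_self_diffStep_mulVec_le G k _).trans
      (mul_le_mul_of_nonneg_left ih (by positivity))

end Graph

/-! ### Penalised least squares -/

section Lasso

variable {N n : ℕ}

lemma dotProduct_sampleCov_mulVec (X : Matrix (Fin N) (Fin n) ℝ) (u v : Fin n → ℝ) :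
    u ⬝ᵥ (sampleCov X *ᵥ v) = 1 / (N : ℝ) * ((X *ᵥ u) ⬝ᵥ (X *ᵥ v)) := by
  rw [sampleCov, smul_mulVec, dotProduct_smul, smul_eq_mul, ← mulVec_mulVec,
    dotProduct_mulVec, vecMul_transpose]

lemma isSymm_sampleCov (X : Matrix (Fin N) (Fin n) ℝ) : (sampleCov X).IsSymm := by
  simp [IsSymm, sampleCov, transpose_smul, transpose_mul]

lemma sum_sq_sub_mulVec_eq (X : Matrix (Fin N) (Fin n) ℝ) (β b : Fin n → ℝ) (ε : Fin N → ℝ) :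
    ∑ i, ((X *ᵥ β + ε) i - (X *ᵥ b) i) ^ 2 =
      ε ⬝ᵥ ε - 2 * ((Xᵀ *ᵥ ε) ⬝ᵥ (b - β)) + (X *ᵥ (b - β)) ⬝ᵥ (X *ᵥ (b - β)) := by
  rw [mulVec_transpose, ← dotProduct_mulVec, mulVec_sub]
  simp only [dotProduct, Finset.mul_sum, ← Finset.sum_sub_distrib, ← Finset.sum_add_distrib]
  refine Finset.sum_congr rfl fun i _ => ?_
  simp only [Pi.add_apply, Pi.sub_apply]
  ring

lemma penalizedLeastSquares_basic_inequality {X : Matrix (Fin N) (Fin n) ℝ} {ε : Fin N → ℝ}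
    {β b : Fin n → ℝ} {pen : (Fin n → ℝ) → ℝ} {lam : ℝ} (hN : 0 < N)
    (hopt : 1 / (2 * (N : ℝ)) * ∑ i, ((X *ᵥ β + ε) i - (X *ᵥ b) i) ^ 2 + pen b ≤
      1 / (2 * (N : ℝ)) * ∑ i, ((X *ᵥ β + ε) i - (X *ᵥ β) i) ^ 2 + pen β)
    (hnoise : ∀ l, |(Xᵀ *ᵥ ε) l| ≤ N * (lam / 2)) :
    (b - β) ⬝ᵥ (sampleCov X *ᵥ (b - β)) ≤ 2 * (pen β - pen b) + lam * l1Norm (b - β) := by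
  have hN' : (0 : ℝ) < N := mod_cast hN
  simp only [sum_sq_sub_mulVec_eq, sub_self, mulVec_zero, dotProduct_zero] at hopt
  have hcross : (Xᵀ *ᵥ ε) ⬝ᵥ (b - β) ≤ N * (lam / 2) * l1Norm (b - β) :=
    (le_abs_self _).trans (abs_dotProduct_le_mul_l1Norm hnoise)
  rw [dotProduct_sampleCov_mulVec]
  field_simp at hopt ⊢
  linarith

lemma augmentedLasso_cone_inequality {X : Matrix (Fin N) (Fin n) ℝ} {ε : Fin N → ℝ}
    {β b : Fin n → ℝ} {pen : (Fin n → ℝ) → ℝ} {lam : ℝ} {s : ℕ} (hN : 0 < N) (hlam : 0 ≤ lam)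
    (hs : l0Norm β ≤ s)
    (hopt : 1 / (2 * (N : ℝ)) * ∑ i, ((X *ᵥ β + ε) i - (X *ᵥ b) i) ^ 2 + pen b + lam * l1Norm b ≤
      1 / (2 * (N : ℝ)) * ∑ i, ((X *ᵥ β + ε) i - (X *ᵥ β) i) ^ 2 + pen β + lam * l1Norm β)
    (hpen : pen β - pen b ≤ lam * (√s * √((b - β) ⬝ᵥ (b - β))))
    (hnoise : ∀ l, |(Xᵀ *ᵥ ε) l| ≤ N * (lam / 2)) :
    (b - β) ⬝ᵥ (sampleCov X *ᵥ (b - β)) + lam * l1Norm (b - β) ≤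
      6 * lam * (√s * √((b - β) ⬝ᵥ (b - β))) := by
  simp only [add_assoc] at hopt
  have hbasic := penalizedLeastSquares_basic_inequality
    (pen := fun β => pen β + lam * l1Norm β) hN hopt hnoise
  have hl1 : lam * (l1Norm β - l1Norm b + l1Norm (b - β)) ≤
      lam * (2 * (√s * √((b - β) ⬝ᵥ (b - β)))) := by
    refine mul_le_mul_of_nonneg_left ((l1Norm_sub_add_l1Norm_sub_le β b).trans ?_) hlam
    gcongr
  linarith

/-- The restricted eigenvalue condition: `Γ` has curvature at least `κ` along every vector `v` with
`‖v‖₁² ≤ r ‖v‖₂²`. -/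
def HasRestrictedEigenvalue {ι : Type*} [Fintype ι] (κ r : ℝ) (Γ : Matrix ι ι ℝ) : Prop :=
  ∀ v : ι → ℝ, l1Norm v ^ 2 ≤ r * (v ⬝ᵥ v) → κ * (v ⬝ᵥ v) ≤ v ⬝ᵥ (Γ *ᵥ v)

lemma HasRestrictedEigenvalue.l1Norm_le {ι : Type*} [Fintype ι] {Γ : Matrix ι ι ℝ}
    {κ lam s : ℝ} {v : ι → ℝ} (hΓ : HasRestrictedEigenvalue κ (36 * s) Γ) (hκ : 0 < κ)
    (hlam : 0 < lam) (hs : 0 ≤ s) (hpsd : 0 ≤ v ⬝ᵥ (Γ *ᵥ v))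
    (hv : v ⬝ᵥ (Γ *ᵥ v) + lam * l1Norm v ≤ 6 * lam * (√s * √(v ⬝ᵥ v))) :
    l1Norm v ≤ 9 / κ * s * lam := by
  have hcone : l1Norm v ≤ 6 * (√s * √(v ⬝ᵥ v)) :=
    le_of_mul_le_mul_left (by linarith) hlam
  have hcone_sq : l1Norm v ^ 2 ≤ 36 * s * (v ⬝ᵥ v) :=
    calc l1Norm v ^ 2 ≤ (6 * (√s * √(v ⬝ᵥ v))) ^ 2 := by gcongr; exact l1Norm_nonneg v
      _ = 36 * √s ^ 2 * √(v ⬝ᵥ v) ^ 2 := by ring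
      _ = 36 * s * (v ⬝ᵥ v) := by rw [Real.sq_sqrt hs, Real.sq_sqrt (dotProduct_self_nonneg v)]
  have hcurv : κ * √(v ⬝ᵥ v) ^ 2 + lam * l1Norm v ≤ 6 * lam * (√s * √(v ⬝ᵥ v)) := by
    rw [Real.sq_sqrt (dotProduct_self_nonneg v)]
    linarith [hΓ v hcone_sq]
  have hyoung : κ * (6 * lam * (√s * √(v ⬝ᵥ v))) ≤
      κ * (κ * √(v ⬝ᵥ v) ^ 2) + lam * (9 * s * lam) := by
    linear_combination sq_nonneg (κ * √(v ⬝ᵥ v) - 3 * lam * √s) + 9 * lam ^ 2 * Real.sq_sqrt hs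
  have hscaled : lam * (κ * l1Norm v) ≤ lam * (9 * s * lam) := by
    linarith [mul_le_mul_of_nonneg_left hcurv hκ.le]
  calc l1Norm v ≤ 9 * s * lam / κ := (le_div_iff₀' hκ).2 (le_of_mul_le_mul_left hscaled hlam)
    _ = 9 / κ * s * lam := by ring

lemma graphPenalty_sub_le {G : SimpleGraph (Fin n)} {k s₁ s₂ : ℕ} {ν lam : ℝ} (hν : 0 ≤ ν)
    (hlam : 0 ≤ lam) (hνs : ν * s₁ ≤ s₂) {β b : Fin n → ℝ}
    (hβ : l0Norm (diffOp G k *ᵥ β) ≤ s₁) :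
    lam * √(ν / (2 * (maxDeg G : ℝ)) ^ (k + 1)) *
        (l1Norm (diffOp G k *ᵥ β) - l1Norm (diffOp G k *ᵥ b)) ≤
      lam * (√s₂ * √((b - β) ⬝ᵥ (b - β))) := by
  set D : ℝ := (2 * (maxDeg G : ℝ)) ^ (k + 1)
  set q := (b - β) ⬝ᵥ (b - β)
  have : 0 ≤ D := by positivity
  have : 0 ≤ q := dotProduct_self_nonneg _
  have hdiff : l1Norm (diffOp G k *ᵥ β) - l1Norm (diffOp G k *ᵥ b) ≤ √s₁ * √(D * q) := by
    refine (l1Norm_sub_le _ _).trans ?_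
    rw [← mulVec_sub]
    gcongr
    exact dotProduct_self_diffOp_mulVec_le G k _
  have hsqrt : √(ν / D) * (√s₁ * √(D * q)) ≤ √s₂ * √q := by
    rw [← Real.sqrt_mul (by positivity), ← Real.sqrt_mul (by positivity),
      ← Real.sqrt_mul (by positivity)]
    apply Real.sqrt_le_sqrt
    calc ν / D * (s₁ * (D * q)) = ν * s₁ * q * (D / D) := by ring
      _ ≤ ν * s₁ * q := mul_le_of_le_one_right (by positivity) (div_self_le_one D)
      _ ≤ s₂ * q := by gcongr
  rw [mul_assoc]
  exact mul_le_mul_of_nonneg_left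
    ((mul_le_mul_of_nonneg_left hdiff (Real.sqrt_nonneg _)).trans hsqrt) hlam

lemma IsGPPLasso.l1Norm_sub_le {G : SimpleGraph (Fin n)} {k s₁ s₂ : ℕ} {ν lam κ : ℝ}
    {X : Matrix (Fin N) (Fin n) ℝ} {ε : Fin N → ℝ} {β b : Fin n → ℝ}
    (hopt : IsGPPLasso G k lam (lam * √(ν / (2 * (maxDeg G : ℝ)) ^ (k + 1))) X (X *ᵥ β + ε) b)
    (hN : 0 < N) (hν : 0 ≤ ν) (hlam : 0 < lam) (hκ : 0 < κ) (hνs : ν * s₁ ≤ s₂)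
    (hβ : β ∈ paramSpace G k s₁ s₂) (hnoise : ∀ l, |(Xᵀ *ᵥ ε) l| ≤ N * (lam / 2))
    (hRE : HasRestrictedEigenvalue κ (36 * s₂) (sampleCov X)) :
    l1Norm (b - β) ≤ 9 / κ * s₂ * lam := by
  refine hRE.l1Norm_le hκ hlam (Nat.cast_nonneg _) ?_
    (augmentedLasso_cone_inequality (pen := fun β => _ * l1Norm (diffOp G k *ᵥ β))
      hN hlam.le hβ.2 (hopt β) ?_ hnoise)
  · rw [dotProduct_sampleCov_mulVec]
    exact mul_nonneg (by positivity) (dotProduct_self_nonneg _)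
  · rw [← mul_sub]
    exact graphPenalty_sub_le hν hlam.le hνs hβ.1

end Lasso

/-! ### CLIME solutions -/

section CLIME

variable {N n : ℕ}

lemma CLIMEFeasible.nonneg {μ : ℝ} {Γ Θ : Matrix (Fin n) (Fin n) ℝ}
    (h : CLIMEFeasible μ Γ Θ) : 0 ≤ μ :=
  (matSupNorm_nonneg _).trans h

lemma CLIMEFeasible.abs_le {μ : ℝ} {Γ Θ : Matrix (Fin n) (Fin n) ℝ}
    (h : CLIMEFeasible μ Γ Θ) (i j : Fin n) : |(Θ * Γ - 1) i j| ≤ μ :=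
  (abs_le_matSupNorm _ _ _).trans h

lemma CLIMEFeasible.updateRow {μ : ℝ} {Γ Θ Θ₀ : Matrix (Fin n) (Fin n) ℝ}
    (h : CLIMEFeasible μ Γ Θ) (h₀ : CLIMEFeasible μ Γ Θ₀) (i : Fin n) :
    CLIMEFeasible μ Γ (Θ.updateRow i (Θ₀ i)) := by
  refine matSupNorm_le h.nonneg fun r l => ?_
  by_cases hri : r = i
  · subst hri
    simpa [mul_apply] using h₀.abs_le r l
  · simpa [mul_apply, hri] using h.abs_le r l

lemma IsCLIME.l1Norm_row_le {μ : ℝ} {Γ Θ Θ₀ : Matrix (Fin n) (Fin n) ℝ} (h : IsCLIME μ Γ Θ)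
    (h₀ : CLIMEFeasible μ Γ Θ₀) (i : Fin n) : l1Norm (Θ i) ≤ l1Norm (Θ₀ i) := by
  have hmin : ∑ r, l1Norm (Θ r) ≤ ∑ r, l1Norm (Θ.updateRow i (Θ₀ i) r) :=
    h.2 _ (h.1.updateRow h₀ i)
  have hrest : ∑ r ∈ Finset.univ.erase i, l1Norm (Θ.updateRow i (Θ₀ i) r) =
      ∑ r ∈ Finset.univ.erase i, l1Norm (Θ r) :=
    Finset.sum_congr rfl fun r hr => by rw [updateRow_ne (Finset.ne_of_mem_erase hr)]
  rw [← Finset.add_sum_erase _ _ (Finset.mem_univ i),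
    ← Finset.add_sum_erase _ _ (Finset.mem_univ i), hrest, updateRow_self] at hmin
  exact le_of_add_le_add_right hmin

lemma abs_mul_transpose_apply_le {ι κ l : Type*} [Fintype l] {A : Matrix ι l ℝ} {B : Matrix κ l ℝ}
    {a b : ℝ} (ha : 0 ≤ a) (hA : ∀ i j, |A i j| ≤ a) (hB : ∀ i, l1Norm (B i) ≤ b) (i : ι) (j : κ) :
    |(A * Bᵀ) i j| ≤ a * b :=
  (abs_dotProduct_le_mul_l1Norm (hA i)).trans (mul_le_mul_of_nonneg_left (hB j) ha)

lemma IsCLIME.matSupNorm_sub_le {μ M : ℝ} {Γ Θ W : Matrix (Fin n) (Fin n) ℝ}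
    (h : IsCLIME μ Γ Θ) (hΓ : Γ.IsSymm) (hW : W.IsSymm) (hfeas : CLIMEFeasible μ Γ W)
    (hM : opNormInf W ≤ M) : matSupNorm (Θ * Γ * Θᵀ - W) ≤ 3 * (M * μ) := by
  have hμ : 0 ≤ μ := hfeas.nonneg
  have : 0 ≤ M := (opNormInf_nonneg W).trans hM
  have hWrow (i) : l1Norm (W i) ≤ M := (l1Norm_row_le_opNormInf W i).trans hM
  have hΘrow (i) : l1Norm (Θ i) ≤ M := (h.l1Norm_row_le hfeas i).trans (hWrow i)
  have hdecomp : Θ * Γ * Θᵀ - W =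
      (Θ * Γ - 1) * Θᵀ + (((Θ * Γ - 1) * Wᵀ)ᵀ - (W * Γ - 1) * Θᵀ) := by
    rw [hW.eq, transpose_mul, hW.eq, transpose_sub, transpose_mul, hΓ.eq, transpose_one]
    noncomm_ring
  refine matSupNorm_le (by positivity) fun i j => ?_
  have hΘΘ := abs_mul_transpose_apply_le hμ h.1.abs_le hΘrow i j
  have hΘW := abs_mul_transpose_apply_le hμ h.1.abs_le hWrow j i
  have hWΘ := abs_mul_transpose_apply_le hμ hfeas.abs_le hΘrow i j
  rw [hdecomp]
  calc _ ≤ |((Θ * Γ - 1) * Θᵀ) i j| +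
        (|((Θ * Γ - 1) * Wᵀ) j i| + |((W * Γ - 1) * Θᵀ) i j|) :=
        (abs_add_le _ _).trans (add_le_add_right (abs_sub _ _) _)
    _ ≤ 3 * (M * μ) := by linarith

lemma vecSupNorm_remainderTerm_le {X : Matrix (Fin N) (Fin n) ℝ} {Θ : Matrix (Fin n) (Fin n) ℝ}
    {μ : ℝ} (h : CLIMEFeasible μ (sampleCov X) Θ) (b β : Fin n → ℝ) :
    vecSupNorm (remainderTerm X Θ b β) ≤ √N * (μ * l1Norm (b - β)) := by
  refine vecSupNorm_le (mul_nonneg (Real.sqrt_nonneg _)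
    (mul_nonneg h.nonneg (l1Norm_nonneg _))) fun i => ?_
  rw [remainderTerm, Pi.smul_apply, smul_eq_mul, abs_mul, abs_of_nonneg (Real.sqrt_nonneg _)]
  exact mul_le_mul_of_nonneg_left (abs_dotProduct_le_mul_l1Norm (h.abs_le i)) (Real.sqrt_nonneg _)

lemma sqrt_smul_oneStep_sub_eq (X : Matrix (Fin N) (Fin n) ℝ) (Θ : Matrix (Fin n) (Fin n) ℝ)
    (b β : Fin n → ℝ) (ε : Fin N → ℝ) :
    √(N : ℝ) • (oneStep X (X *ᵥ β + ε) Θ b - β) = leadingTerm X Θ ε - remainderTerm X Θ b β := by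
  have hdiv : √(N : ℝ) * (1 / (N : ℝ)) = 1 / √(N : ℝ) := by
    rw [mul_one_div, Real.sqrt_div_self']
  have hres : X *ᵥ β + ε - X *ᵥ b = ε - X *ᵥ (b - β) := by
    rw [mulVec_sub]; abel
  have hcov : (Θ * sampleCov X) *ᵥ (b - β) = (1 / (N : ℝ)) • ((Θ * Xᵀ) *ᵥ (X *ᵥ (b - β))) := by
    rw [sampleCov, Matrix.mul_smul, smul_mulVec, mulVec_mulVec, Matrix.mul_assoc]
  rw [oneStep, leadingTerm, remainderTerm, hres, ← hdiv, sub_mulVec, hcov, one_mulVec,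
    mulVec_sub (Θ * Xᵀ)]
  simp only [smul_sub, smul_add, smul_smul]
  abel

end CLIME

/-! ### Restricted eigenvalues from sparse vectors -/

section Maurey

lemma bilinForm_average_nonneg {α V : Type*} [Fintype α] [AddCommGroup V] [Module ℝ V]
    (B : LinearMap.BilinForm ℝ V) {p : α → ℝ} (hp : ∀ a, 0 ≤ p a) (hp1 : ∑ a, p a = 1)
    (e : α → V) (r : ℕ) (x : V)
    (h : ∀ f : Fin r → α, 0 ≤ B (x + ∑ l, e (f l)) (x + ∑ l, e (f l))) :
    0 ≤ B x x + r * (B x (∑ a, p a • e a) + B (∑ a, p a • e a) x) + r * ∑ a, p a * B (e a) (e a)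
      + r * (r - 1) * B (∑ a, p a • e a) (∑ a, p a • e a) := by
  set w := ∑ a, p a • e a with hw
  set T := ∑ a, p a * B (e a) (e a) with hT
  induction r generalizing x with
  | zero => simpa using h Fin.elim0
  | succ r ih =>
    have hcond (a : α) : 0 ≤ B (x + e a) (x + e a) + r * (B (x + e a) w + B w (x + e a)) + r * T
        + r * (r - 1) * B w w := by
      refine ih (x + e a) fun f => ?_
      simpa [Fin.sum_univ_succ, add_assoc] using h (Fin.cons a f)
    have hright (u : V) : ∑ a, p a * B u (e a) = B u w := by simp [hw]
    have hleft (u : V) : ∑ a, p a * B (e a) u = B w u := by simp [hw]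
    calc 0 ≤ ∑ a, p a * (B (x + e a) (x + e a) + r * (B (x + e a) w + B w (x + e a)) + r * T
          + r * (r - 1) * B w w) := Finset.sum_nonneg fun a _ => mul_nonneg (hp a) (hcond a)
      _ = (∑ a, p a) * (B x x + r * (B x w + B w x) + r * T + r * (r - 1) * B w w)
          + ∑ a, p a * B x (e a) + ∑ a, p a * B (e a) x + ∑ a, p a * B (e a) (e a)
          + r * ∑ a, p a * B (e a) w + r * ∑ a, p a * B w (e a) := by
        simp only [Finset.sum_mul, Finset.mul_sum, ← Finset.sum_add_distrib, map_add,
          LinearMap.add_apply]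
        exact Finset.sum_congr rfl fun a _ => by ring
      _ = _ := by
        rw [hp1, hright, hright, hleft, hleft, ← hT]
        push_cast
        ring

lemma exists_abs_mul_unit_eq (x : ℝ) : ∃ s : ℤˣ, |x| * ((s : ℤ) : ℝ) = x := by
  rcases le_total 0 x with hx | hx
  · exact ⟨1, by simp [abs_of_nonneg hx]⟩
  · exact ⟨-1, by simp [abs_of_nonpos hx]⟩

variable {ι : Type*} [DecidableEq ι]

/-- The sum of the signed coordinate vectors `± e_i` listed by `f`. -/
def signedSum {r : ℕ} (f : Fin r → ι × ℤˣ) : ι → ℝ :=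
  ∑ l, Pi.single (f l).1 (((f l).2 : ℤ) : ℝ)

variable [Fintype ι]

lemma quadForm_ge_of_signedSum {Γ : Matrix ι ι ℝ} {D : ℝ} (hD : ∀ i, Γ i i ≤ D) {m : ℕ}
    (h : ∀ f : Fin (m + 1) → ι × ℤˣ, 0 ≤ signedSum f ⬝ᵥ (Γ *ᵥ signedSum f)) (v : ι → ℝ) :
    0 ≤ D * l1Norm v ^ 2 + m * (v ⬝ᵥ (Γ *ᵥ v)) := by
  rcases (l1Norm_nonneg v).eq_or_lt with h0 | hL
  · have hv : v = 0 := funext fun i => by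
      simpa using (Finset.sum_eq_zero_iff_of_nonneg fun i _ => abs_nonneg (v i)).1 h0.symm i
    simp [hv, l1Norm]
  set L := l1Norm v
  choose sgn hsgn using fun i => exists_abs_mul_unit_eq (v i)
  have hp1 : ∑ i, |v i| / L = 1 := by rw [← Finset.sum_div]; exact div_self hL.ne'
  have hmean : ∑ i, (|v i| / L) • (Pi.single i ((sgn i : ℤ) : ℝ) : ι → ℝ) = L⁻¹ • v := by
    ext j
    simp only [Finset.sum_apply, Pi.smul_apply, Pi.single_apply, smul_eq_mul, mul_ite, mul_zero,
      Finset.sum_ite_eq, Finset.mem_univ, if_true]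
    rw [div_eq_inv_mul, mul_assoc, hsgn]
  have hdiag (i : ι) : Matrix.toBilin' Γ (Pi.single i ((sgn i : ℤ) : ℝ))
      (Pi.single i ((sgn i : ℤ) : ℝ)) = Γ i i := by
    rcases Int.units_eq_one_or (sgn i) with hi | hi <;>
      simp [hi, Matrix.toBilin'_apply', Matrix.mulVec_single]
  have key := bilinForm_average_nonneg (Matrix.toBilin' Γ) (p := fun i => |v i| / L)
    (fun i => by positivity) hp1 (fun i => Pi.single i ((sgn i : ℤ) : ℝ)) (m + 1) 0
    (fun f => by
      rw [zero_add, Matrix.toBilin'_apply']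
      exact h fun l => (f l, sgn (f l)))
  simp only [hmean, hdiag, Matrix.toBilin'_apply', zero_dotProduct, mulVec_zero, dotProduct_zero,
    mulVec_smul, dotProduct_smul, smul_dotProduct, smul_eq_mul] at key
  have havg : ∑ i, |v i| / L * Γ i i ≤ D :=
    calc ∑ i, |v i| / L * Γ i i ≤ ∑ i, |v i| / L * D := by gcongr with i; exact hD i
      _ = D := by rw [← Finset.sum_mul, hp1, one_mul]
  have hscaled : 0 ≤ ((m : ℝ) + 1) * (D + m * (L⁻¹ * (L⁻¹ * (v ⬝ᵥ (Γ *ᵥ v))))) := by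
    push_cast at key
    linarith [mul_le_mul_of_nonneg_left havg (by positivity : (0 : ℝ) ≤ m + 1)]
  calc 0 ≤ (D + m * (L⁻¹ * (L⁻¹ * (v ⬝ᵥ (Γ *ᵥ v))))) * L ^ 2 :=
        mul_nonneg (nonneg_of_mul_nonneg_right hscaled (by positivity)) (sq_nonneg L)
    _ = D * L ^ 2 + m * (v ⬝ᵥ (Γ *ᵥ v)) := by field_simp

lemma hasRestrictedEigenvalue_of_signedSum {Γ : Matrix ι ι ℝ} {D κ r : ℝ} (hκ : 0 ≤ κ)
    (hD : ∀ i, Γ i i ≤ D) (hD0 : 0 ≤ D) {m : ℕ} (hm : 0 < m) (hmr : 2 * D * r ≤ κ * m)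
    (h : ∀ f : Fin (m + 1) → ι × ℤˣ,
      κ * (signedSum f ⬝ᵥ signedSum f) ≤ signedSum f ⬝ᵥ (Γ *ᵥ signedSum f)) :
    HasRestrictedEigenvalue (κ / 2) r Γ := by
  intro v hv
  have hquad (u : ι → ℝ) :
      u ⬝ᵥ ((Γ - κ • (1 : Matrix ι ι ℝ)) *ᵥ u) = u ⬝ᵥ (Γ *ᵥ u) - κ * (u ⬝ᵥ u) := by
    rw [sub_mulVec, smul_mulVec, one_mulVec, dotProduct_sub, dotProduct_smul, smul_eq_mul]
  have hdiag (i : ι) : (Γ - κ • (1 : Matrix ι ι ℝ)) i i ≤ D := by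
    rw [Matrix.sub_apply, Matrix.smul_apply, Matrix.one_apply_eq, smul_eq_mul, mul_one]
    linarith [hD i]
  have key := quadForm_ge_of_signedSum hdiag
    (fun f => by rw [hquad]; exact sub_nonneg.2 (h f)) v
  rw [hquad] at key
  have hl1 : D * l1Norm v ^ 2 ≤ κ * m / 2 * (v ⬝ᵥ v) :=
    calc D * l1Norm v ^ 2 ≤ D * (r * (v ⬝ᵥ v)) := mul_le_mul_of_nonneg_left hv hD0
      _ = D * r * (v ⬝ᵥ v) := by ring
      _ ≤ κ * m / 2 * (v ⬝ᵥ v) := by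
        gcongr
        · exact dotProduct_self_nonneg v
        · linarith
  have hscaled : (m : ℝ) * (κ / 2 * (v ⬝ᵥ v)) ≤ m * (v ⬝ᵥ (Γ *ᵥ v)) := by linarith
  exact le_of_mul_le_mul_left hscaled (by exact_mod_cast hm)

end Maurey

/-! ### Sub-exponential random variables -/

section Subexponential

variable {Ω : Type*} [MeasurableSpace Ω] {P : Measure Ω} {a : ℝ} {W : Ω → ℝ}

/-- `W` is sub-exponential with parameter `a`: for `0 < a`, its Orlicz `ψ₁`-norm is at most
`1 / a`. -/
structure IsSubexponential (a : ℝ) (W : Ω → ℝ) (P : Measure Ω) : Prop where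
  aemeasurable : AEMeasurable W P
  integrable_exp : Integrable (fun ω => Real.exp (a * |W ω|)) P
  integral_exp_le : ∫ ω, Real.exp (a * |W ω|) ∂P ≤ 2

lemma isSubexponential_of_lintegral_exp_le (hW : AEMeasurable W P)
    (h : ∫⁻ ω, ENNReal.ofReal (Real.exp (a * |W ω|)) ∂P ≤ 2) : IsSubexponential a W P := by
  have hnonneg : 0 ≤ᵐ[P] fun ω => Real.exp (a * |W ω|) := ae_of_all _ fun ω => (Real.exp_pos _).le
  have hint : Integrable (fun ω => Real.exp (a * |W ω|)) P := by
    rw [← lintegral_ofReal_ne_top_iff_integrable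
      (AEMeasurable.aestronglyMeasurable (by fun_prop)) hnonneg]
    exact (h.trans_lt ENNReal.ofNat_lt_top).ne
  refine ⟨hW, hint, ?_⟩
  rw [← ofReal_integral_eq_lintegral_ofReal hint hnonneg] at h
  exact (ENNReal.ofReal_le_ofReal_iff zero_le_two).1 (by simpa using h)

lemma IsSubexponential.mul {U V : Ω → ℝ} (hU : IsSubexponential a (fun ω => U ω ^ 2) P)
    (ha : 0 ≤ a) (hUm : AEMeasurable U P) (hVm : AEMeasurable V P)
    (hV : IsSubexponential a (fun ω => V ω ^ 2) P) :
    IsSubexponential a (fun ω => U ω * V ω) P := by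
  have hpt (ω : Ω) : Real.exp (a * |U ω * V ω|)
      ≤ (Real.exp (a * |U ω ^ 2|) + Real.exp (a * |V ω ^ 2|)) / 2 := by
    have hamgm : a * |U ω * V ω| ≤ a * |U ω ^ 2| / 2 + a * |V ω ^ 2| / 2 := by
      rw [abs_mul, abs_pow, abs_pow]
      nlinarith [mul_nonneg ha (sq_nonneg (|U ω| - |V ω|))]
    have hhalf (x : ℝ) : Real.exp x = Real.exp (x / 2) ^ 2 := by
      rw [← Real.exp_nat_mul]
      congr 1
      push_cast
      ring
    calc Real.exp (a * |U ω * V ω|)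
        ≤ Real.exp (a * |U ω ^ 2| / 2) * Real.exp (a * |V ω ^ 2| / 2) := by
          rw [← Real.exp_add]
          exact Real.exp_le_exp.2 hamgm
      _ ≤ (Real.exp (a * |U ω ^ 2|) + Real.exp (a * |V ω ^ 2|)) / 2 := by
          rw [hhalf (a * |U ω ^ 2|), hhalf (a * |V ω ^ 2|)]
          linarith [two_mul_le_add_sq (Real.exp (a * |U ω ^ 2| / 2))
            (Real.exp (a * |V ω ^ 2| / 2))]
  have hdom := (hU.integrable_exp.add hV.integrable_exp).div_const 2
  have hint : Integrable (fun ω => Real.exp (a * |U ω * V ω|)) P :=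
    hdom.mono' (AEMeasurable.aestronglyMeasurable (by fun_prop)) (ae_of_all _ fun ω => by
      rw [Real.norm_eq_abs, Real.abs_exp]
      exact hpt ω)
  refine ⟨hUm.mul hVm, hint, (integral_mono hint hdom hpt).trans ?_⟩
  simp only [Pi.add_apply]
  rw [integral_div, integral_add hU.integrable_exp hV.integrable_exp]
  linarith [hU.integral_exp_le, hV.integral_exp_le]

lemma IsSubexponential.integrable (ha : 0 < a) (h : IsSubexponential a W P) : Integrable W P := by
  refine (h.integrable_exp.const_mul a⁻¹).mono' h.aemeasurable.aestronglyMeasurable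
    (ae_of_all _ fun ω => ?_)
  rw [Real.norm_eq_abs, inv_mul_eq_div, le_div_iff₀ ha]
  linarith [Real.add_one_le_exp (a * |W ω|)]

lemma IsSubexponential.mul_abs_integral_le_one [IsProbabilityMeasure P] (ha : 0 < a)
    (h : IsSubexponential a W P) : a * |∫ ω, W ω ∂P| ≤ 1 :=
  calc a * |∫ ω, W ω ∂P| ≤ a * ∫ ω, |W ω| ∂P := by gcongr; exact abs_integral_le_integral_abs
    _ = ∫ ω, a * |W ω| ∂P := (integral_const_mul a _).symm
    _ ≤ ∫ ω, (Real.exp (a * |W ω|) - 1) ∂P :=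
        integral_mono ((h.integrable ha).abs.const_mul a)
          (h.integrable_exp.sub (integrable_const 1))
          fun ω => by linarith [Real.add_one_le_exp (a * |W ω|)]
    _ ≤ 1 := by
        rw [integral_sub h.integrable_exp (integrable_const 1), integral_const, probReal_univ,
          one_smul]
        linarith [h.integral_exp_le]

lemma exp_mul_le_one_add_add_sq_mul_exp {a t : ℝ} (ha : 0 < a) (ht : |t| ≤ a / 2) (x : ℝ) :
    Real.exp (t * x) ≤ 1 + t * x + 8 * t ^ 2 / a ^ 2 * Real.exp (a * |x|) := by
  have htaylor : |Real.exp (t * x) - (1 + t * x)| ≤ |t * x| ^ 2 * Real.exp |t * x| := by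
    have h := Complex.norm_exp_sub_sum_le_norm_mul_exp ((t * x : ℝ) : ℂ) 2
    rw [Complex.norm_real, Real.norm_eq_abs] at h
    convert h using 1
    rw [← Real.norm_eq_abs, ← Complex.norm_real]
    congr 1
    simp [Finset.sum_range_succ]
  set z := a / 2 * |x| with hz
  have hz0 : 0 ≤ z := by positivity
  have htx : |t * x| ≤ z := by
    rw [abs_mul]
    exact mul_le_mul_of_nonneg_right ht (abs_nonneg x)
  have hzexp : z ^ 2 ≤ 2 * Real.exp z := by
    linarith [Real.quadratic_le_exp_of_nonneg hz0]
  have hsq : |t * x| ^ 2 = 4 * t ^ 2 / a ^ 2 * z ^ 2 := by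
    rw [abs_mul, mul_pow, sq_abs, hz]
    field_simp
    norm_num
  have hexp : Real.exp (a * |x|) = Real.exp z * Real.exp z := by
    rw [← Real.exp_add, hz]
    ring_nf
  calc Real.exp (t * x) ≤ 1 + t * x + |t * x| ^ 2 * Real.exp |t * x| := by
        linarith [(le_abs_self _).trans htaylor]
    _ ≤ 1 + t * x + 4 * t ^ 2 / a ^ 2 * (2 * Real.exp z) * Real.exp z := by
        rw [hsq]
        gcongr
    _ = 1 + t * x + 8 * t ^ 2 / a ^ 2 * Real.exp (a * |x|) := by
        rw [hexp]
        ring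

lemma IsSubexponential.exp_mul_abs_sub_integral_le [IsProbabilityMeasure P] (ha : 0 < a)
    (h : IsSubexponential a W P) (ω : Ω) :
    Real.exp (a * |W ω - ∫ ω', W ω' ∂P|) ≤ 4 * Real.exp (a * |W ω|) := by
  have hshift : a * |W ω - ∫ ω', W ω' ∂P| ≤ 1 + a * |W ω| := by
    linarith [mul_le_mul_of_nonneg_left (abs_sub (W ω) (∫ ω', W ω' ∂P)) ha.le,
      h.mul_abs_integral_le_one ha]
  calc Real.exp (a * |W ω - ∫ ω', W ω' ∂P|) ≤ Real.exp (1 + a * |W ω|) := Real.exp_le_exp.2 hshift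
    _ = Real.exp 1 * Real.exp (a * |W ω|) := Real.exp_add _ _
    _ ≤ 4 * Real.exp (a * |W ω|) := by
        gcongr
        linarith [Real.exp_one_lt_d9]

lemma IsSubexponential.exp_mul_sub_integral_le [IsProbabilityMeasure P] (ha : 0 < a)
    (h : IsSubexponential a W P) {t : ℝ} (ht : |t| ≤ a / 2) (ω : Ω) :
    Real.exp (t * (W ω - ∫ ω', W ω' ∂P))
      ≤ 1 + t * (W ω - ∫ ω', W ω' ∂P) + 32 * t ^ 2 / a ^ 2 * Real.exp (a * |W ω|) :=
  calc Real.exp (t * (W ω - ∫ ω', W ω' ∂P))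
      ≤ 1 + t * (W ω - ∫ ω', W ω' ∂P)
          + 8 * t ^ 2 / a ^ 2 * Real.exp (a * |W ω - ∫ ω', W ω' ∂P|) :=
        exp_mul_le_one_add_add_sq_mul_exp ha ht _
    _ ≤ 1 + t * (W ω - ∫ ω', W ω' ∂P) + 8 * t ^ 2 / a ^ 2 * (4 * Real.exp (a * |W ω|)) := by
        gcongr
        exact h.exp_mul_abs_sub_integral_le ha ω
    _ = _ := by ring

lemma IsSubexponential.mgf_sub_integral_le [IsProbabilityMeasure P] (ha : 0 < a)
    (h : IsSubexponential a W P) {t : ℝ} (ht : |t| ≤ a / 2) :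
    Integrable (fun ω => Real.exp (t * (W ω - ∫ ω', W ω' ∂P))) P ∧
      mgf (fun ω => W ω - ∫ ω', W ω' ∂P) P t ≤ Real.exp (64 * t ^ 2 / a ^ 2) := by
  have hWm := h.aemeasurable
  have hcent : Integrable (fun ω => W ω - ∫ ω', W ω' ∂P) P :=
    (h.integrable ha).sub (integrable_const _)
  have hlin : Integrable (fun ω => 1 + t * (W ω - ∫ ω', W ω' ∂P)) P :=
    (integrable_const _).add (hcent.const_mul t)
  have hquad := h.integrable_exp.const_mul (32 * t ^ 2 / a ^ 2)
  have hint : Integrable (fun ω => Real.exp (t * (W ω - ∫ ω', W ω' ∂P))) P :=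
    (hlin.add hquad).mono' (AEMeasurable.aestronglyMeasurable (by fun_prop))
      (ae_of_all _ fun ω => by
        rw [Real.norm_eq_abs, Real.abs_exp]
        exact h.exp_mul_sub_integral_le ha ht ω)
  refine ⟨hint, ?_⟩
  calc mgf (fun ω => W ω - ∫ ω', W ω' ∂P) P t
      ≤ ∫ ω, (1 + t * (W ω - ∫ ω', W ω' ∂P) + 32 * t ^ 2 / a ^ 2 * Real.exp (a * |W ω|)) ∂P :=
        integral_mono hint (hlin.add hquad) fun ω => h.exp_mul_sub_integral_le ha ht ω
    _ = 1 + 32 * t ^ 2 / a ^ 2 * ∫ ω, Real.exp (a * |W ω|) ∂P := by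
        rw [integral_add hlin hquad, integral_add (integrable_const _) (hcent.const_mul t),
          integral_const_mul, integral_const_mul, integral_sub (h.integrable ha)
          (integrable_const _), integral_const, integral_const, probReal_univ, one_smul, one_smul,
          sub_self, mul_zero, add_zero]
    _ ≤ 1 + 32 * t ^ 2 / a ^ 2 * 2 := by
        gcongr
        exact h.integral_exp_le
    _ = 64 * t ^ 2 / a ^ 2 + 1 := by ring
    _ ≤ Real.exp (64 * t ^ 2 / a ^ 2) := Real.add_one_le_exp _

lemma measureReal_le_abs_le_of_mgf_le [IsFiniteMeasure P] {Y : Ω → ℝ} {t c : ℝ} (ht : 0 ≤ t)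
    (hpos : Integrable (fun ω => Real.exp (t * Y ω)) P)
    (hneg : Integrable (fun ω => Real.exp (-t * Y ω)) P) (hmpos : mgf Y P t ≤ Real.exp c)
    (hmneg : mgf Y P (-t) ≤ Real.exp c) (b : ℝ) :
    P.real {ω | b ≤ |Y ω|} ≤ 2 * Real.exp (c - t * b) := by
  have hsub : {ω | b ≤ |Y ω|} ⊆ {ω | b ≤ Y ω} ∪ {ω | Y ω ≤ -b} := by
    intro ω hω
    rcases le_abs.1 (show b ≤ |Y ω| from hω) with h | h
    · exact Or.inl h
    · exact Or.inr (show Y ω ≤ -b by linarith)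
  have hup : P.real {ω | b ≤ Y ω} ≤ Real.exp (c - t * b) :=
    calc P.real {ω | b ≤ Y ω} ≤ Real.exp (-t * b) * mgf Y P t := measure_ge_le_exp_mul_mgf b ht hpos
      _ ≤ Real.exp (-t * b) * Real.exp c := by gcongr
      _ = Real.exp (c - t * b) := by rw [← Real.exp_add]; ring_nf
  have hlow : P.real {ω | Y ω ≤ -b} ≤ Real.exp (c - t * b) :=
    calc P.real {ω | Y ω ≤ -b} ≤ Real.exp (- -t * -b) * mgf Y P (-t) :=
          measure_le_le_exp_mul_mgf (-b) (neg_nonpos.2 ht) hneg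
      _ ≤ Real.exp (- -t * -b) * Real.exp c := by gcongr
      _ = Real.exp (c - t * b) := by rw [← Real.exp_add]; ring_nf
  calc P.real {ω | b ≤ |Y ω|} ≤ P.real ({ω | b ≤ Y ω} ∪ {ω | Y ω ≤ -b}) := measureReal_mono hsub
    _ ≤ P.real {ω | b ≤ Y ω} + P.real {ω | Y ω ≤ -b} := measureReal_union_le _ _
    _ ≤ 2 * Real.exp (c - t * b) := by linarith

lemma mgf_sum_sub_integral_le {ι : Type*} [Fintype ι] {W : ι → Ω → ℝ} (ha : 0 < a)
    (hind : iIndepFun W P) (hW : ∀ i, IsSubexponential a (W i) P) {t : ℝ} (ht : |t| ≤ a / 2) :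
    Integrable (fun ω => Real.exp (t * ∑ i, (W i ω - ∫ ω', W i ω' ∂P))) P ∧
      mgf (fun ω => ∑ i, (W i ω - ∫ ω', W i ω' ∂P)) P t
        ≤ Real.exp (Fintype.card ι * (64 * t ^ 2 / a ^ 2)) := by
  have := hind.isProbabilityMeasure
  have hone (i : ι) := (hW i).mgf_sub_integral_le ha ht
  have hmgf : mgf (fun ω => ∑ i, (W i ω - ∫ ω', W i ω' ∂P)) P t
      = ∏ i, mgf (fun ω => W i ω - ∫ ω', W i ω' ∂P) P t := by
    have hind' : iIndepFun (fun i ω => W i ω - ∫ ω', W i ω' ∂P) P :=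
      hind.comp (fun i x => x - ∫ ω', W i ω' ∂P) fun i => by fun_prop
    rw [← hind'.mgf_sum₀ (fun i => (hW i).aemeasurable.sub_const _) Finset.univ]
    congr 1
    ext ω
    simp only [Finset.sum_apply]
  constructor
  · by_contra hnot
    have hpos : 0 < ∏ i, mgf (fun ω => W i ω - ∫ ω', W i ω' ∂P) P t :=
      Finset.prod_pos fun i _ => mgf_pos (hone i).1
    rw [← hmgf, mgf_undef hnot] at hpos
    exact hpos.false
  · calc mgf (fun ω => ∑ i, (W i ω - ∫ ω', W i ω' ∂P)) P t
        = ∏ i, mgf (fun ω => W i ω - ∫ ω', W i ω' ∂P) P t := hmgf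
      _ ≤ ∏ _i : ι, Real.exp (64 * t ^ 2 / a ^ 2) :=
          Finset.prod_le_prod (fun i _ => mgf_nonneg) fun i _ => (hone i).2
      _ = Real.exp (Fintype.card ι * (64 * t ^ 2 / a ^ 2)) := by
          rw [Finset.prod_const, Finset.card_univ, ← Real.exp_nat_mul]

lemma measureReal_le_abs_sum_sub_integral_le {ι : Type*} [Fintype ι] {W : ι → Ω → ℝ}
    (ha : 0 < a) (hind : iIndepFun W P) (hW : ∀ i, IsSubexponential a (W i) P) {b : ℝ}
    (hb0 : 0 ≤ b) (hb : b ≤ 64 / a) :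
    P.real {ω | Fintype.card ι * b ≤ |∑ i, (W i ω - ∫ ω', W i ω' ∂P)|}
      ≤ 2 * Real.exp (-(Fintype.card ι * (a ^ 2 / 256 * b ^ 2))) := by
  have := hind.isProbabilityMeasure
  -- The exponent `64 t² / a² - t b` is minimal at this `t`.
  set t := a ^ 2 * b / 128
  have ht0 : 0 ≤ t := by positivity
  have ht : |t| ≤ a / 2 := by
    rw [abs_of_nonneg ht0]
    calc a ^ 2 * b / 128 ≤ a ^ 2 * (64 / a) / 128 := by gcongr
      _ = a / 2 := by field_simp; norm_num
  have hpos := mgf_sum_sub_integral_le ha hind hW ht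
  have hneg := mgf_sum_sub_integral_le ha hind hW ((abs_neg t).trans_le ht)
  rw [neg_sq] at hneg
  refine (measureReal_le_abs_le_of_mgf_le ht0 hpos.1 hneg.1 hpos.2 hneg.2 _).trans_eq ?_
  congr 2
  simp only [t]
  field_simp
  ring

end Subexponential

/-! ### Squares of sub-Gaussian random variables -/

section SubgaussianSquare

lemma two_mul_factorial_le (p : ℕ) :
    ((2 * p).factorial : ℝ) ≤ p.factorial * (2 * p : ℝ) ^ p := by
  rw [two_mul p, ← Nat.factorial_mul_ascFactorial p p]
  exact_mod_cast Nat.mul_le_mul_left _ ((Nat.ascFactorial_le_pow_add p p).trans_eq (by ring))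

lemma pow_div_factorial_le_cosh (x : ℝ) (p : ℕ) :
    x ^ (2 * p) / (2 * p).factorial ≤ Real.cosh x :=
  le_hasSum (Real.hasSum_cosh x) p fun q _ =>
    div_nonneg ((even_two_mul q).pow_nonneg x) (Nat.cast_nonneg _)

lemma mul_sq_pow_div_factorial_le_cosh {σ : ℝ} (hσ : 0 < σ) (x : ℝ) (p : ℕ) :
    (1 / (6 * σ ^ 2) * x ^ 2) ^ p / p.factorial
      ≤ (1 / 6) ^ p * Real.cosh (√(2 * p) / σ * x) :=
  calc (1 / (6 * σ ^ 2) * x ^ 2) ^ p / p.factorial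
      = (1 / 6) ^ p * ((x ^ 2 / σ ^ 2) ^ p / p.factorial) := by
        rw [← mul_div_assoc, ← mul_pow]
        congr 2
        field_simp
    _ ≤ (1 / 6) ^ p * ((2 * p : ℝ) ^ p * (x ^ 2 / σ ^ 2) ^ p / (2 * p).factorial) := by
        gcongr ?_ * ?_
        rw [div_le_div_iff₀ (by positivity) (by positivity)]
        linarith [mul_le_mul_of_nonneg_left (two_mul_factorial_le p)
          (show 0 ≤ (x ^ 2 / σ ^ 2) ^ p by positivity)]
    _ = (1 / 6) ^ p * ((√(2 * p) / σ * x) ^ (2 * p) / (2 * p).factorial) := by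
        rw [pow_mul, mul_pow (_ / _) x 2, div_pow (√_) σ 2, Real.sq_sqrt (by positivity),
          ← mul_pow]
        congr 3
        ring
    _ ≤ (1 / 6) ^ p * Real.cosh (√(2 * p) / σ * x) := by
        gcongr
        exact pow_div_factorial_le_cosh _ p

variable {Ω : Type*} [MeasurableSpace Ω] {P : Measure Ω} {σ : ℝ} {Z : Ω → ℝ}

lemma lintegral_cosh_le (hZ : HasSubgaussianMGF Z ⟨σ ^ 2, sq_nonneg σ⟩ P) (t : ℝ) :
    ∫⁻ ω, ENNReal.ofReal (Real.cosh (t * Z ω)) ∂P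
      ≤ ENNReal.ofReal (Real.exp (σ ^ 2 * t ^ 2 / 2)) := by
  have hint := hZ.integrable_exp_mul
  have hmgf (s : ℝ) : ∫ ω, Real.exp (s * Z ω) ∂P ≤ Real.exp (σ ^ 2 * s ^ 2 / 2) := hZ.mgf_le s
  have hcosh (ω : Ω) :
      Real.cosh (t * Z ω) = (Real.exp (t * Z ω) + Real.exp (-t * Z ω)) / 2 := by
    rw [Real.cosh_eq, neg_mul]
  simp only [hcosh]
  have hsum : Integrable (fun ω => (Real.exp (t * Z ω) + Real.exp (-t * Z ω)) / 2) P :=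
    ((hint t).add (hint (-t))).div_const 2
  rw [← ofReal_integral_eq_lintegral_ofReal hsum (ae_of_all _ fun ω => by positivity)]
  refine ENNReal.ofReal_le_ofReal ?_
  have hneg := hmgf (-t)
  rw [neg_sq] at hneg
  rw [integral_div, integral_add (hint t) (hint (-t))]
  linarith [hmgf t]

lemma lintegral_mul_sq_pow_div_factorial_le (hσ : 0 < σ)
    (hZ : HasSubgaussianMGF Z ⟨σ ^ 2, sq_nonneg σ⟩ P) (p : ℕ) :
    ∫⁻ ω, ENNReal.ofReal ((1 / (6 * σ ^ 2) * Z ω ^ 2) ^ p / p.factorial) ∂P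
      ≤ ENNReal.ofReal ((1 / 2) ^ p) :=
  calc ∫⁻ ω, ENNReal.ofReal ((1 / (6 * σ ^ 2) * Z ω ^ 2) ^ p / p.factorial) ∂P
      ≤ ∫⁻ ω, ENNReal.ofReal ((1 / 6) ^ p) *
          ENNReal.ofReal (Real.cosh (√(2 * p) / σ * Z ω)) ∂P := by
        refine lintegral_mono fun ω => ?_
        rw [← ENNReal.ofReal_mul (by positivity)]
        exact ENNReal.ofReal_le_ofReal (mul_sq_pow_div_factorial_le_cosh hσ (Z ω) p)
    _ = ENNReal.ofReal ((1 / 6) ^ p) *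
          ∫⁻ ω, ENNReal.ofReal (Real.cosh (√(2 * p) / σ * Z ω)) ∂P :=
        lintegral_const_mul' _ _ ENNReal.ofReal_ne_top
    _ ≤ ENNReal.ofReal ((1 / 6) ^ p) *
          ENNReal.ofReal (Real.exp (σ ^ 2 * (√(2 * p) / σ) ^ 2 / 2)) := by
        gcongr
        exact lintegral_cosh_le hZ _
    _ = ENNReal.ofReal ((1 / 6 * Real.exp 1) ^ p) := by
        have hexponent : σ ^ 2 * (√(2 * p) / σ) ^ 2 / 2 = p * 1 := by
          rw [div_pow, Real.sq_sqrt (by positivity)]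
          field_simp
        rw [hexponent, Real.exp_nat_mul, ← ENNReal.ofReal_mul (by positivity), mul_pow]
    _ ≤ ENNReal.ofReal ((1 / 2) ^ p) := by
        gcongr
        linarith [Real.exp_one_lt_d9]

lemma isSubexponential_sq_of_hasSubgaussianMGF (hσ : 0 < σ)
    (hZ : HasSubgaussianMGF Z ⟨σ ^ 2, sq_nonneg σ⟩ P) :
    IsSubexponential (1 / (6 * σ ^ 2)) (fun ω => Z ω ^ 2) P := by
  have hmeas := hZ.aemeasurable
  refine isSubexponential_of_lintegral_exp_le (by fun_prop) ?_
  have hseries (ω : Ω) : ENNReal.ofReal (Real.exp (1 / (6 * σ ^ 2) * |Z ω ^ 2|))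
      = ∑' p : ℕ, ENNReal.ofReal ((1 / (6 * σ ^ 2) * Z ω ^ 2) ^ p / p.factorial) := by
    have hsum := NormedSpace.expSeries_div_hasSum_exp (1 / (6 * σ ^ 2) * Z ω ^ 2)
    rw [abs_of_nonneg (sq_nonneg _), Real.exp_eq_exp_ℝ, ← hsum.tsum_eq,
      ENNReal.ofReal_tsum_of_nonneg (fun p => by positivity) hsum.summable]
  calc ∫⁻ ω, ENNReal.ofReal (Real.exp (1 / (6 * σ ^ 2) * |Z ω ^ 2|)) ∂P
      = ∑' p : ℕ, ∫⁻ ω, ENNReal.ofReal ((1 / (6 * σ ^ 2) * Z ω ^ 2) ^ p / p.factorial) ∂P := by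
        simp only [hseries]
        exact lintegral_tsum fun p => by fun_prop
    _ ≤ ∑' p : ℕ, ENNReal.ofReal ((1 / 2) ^ p) :=
        ENNReal.tsum_le_tsum fun p => lintegral_mul_sq_pow_div_factorial_le hσ hZ p
    _ = 2 := by
        rw [← ENNReal.ofReal_tsum_of_nonneg (fun p => by positivity) summable_geometric_two,
          tsum_geometric_two, ENNReal.ofReal_ofNat]

lemma isSubexponential_mul_of_hasSubgaussianMGF (hσ : 0 < σ) {U V : Ω → ℝ}
    (hU : HasSubgaussianMGF U ⟨σ ^ 2, sq_nonneg σ⟩ P)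
    (hV : HasSubgaussianMGF V ⟨σ ^ 2, sq_nonneg σ⟩ P) :
    IsSubexponential (1 / (6 * σ ^ 2)) (fun ω => U ω * V ω) P :=
  (isSubexponential_sq_of_hasSubgaussianMGF hσ hU).mul (by positivity) hU.aemeasurable
    hV.aemeasurable (isSubexponential_sq_of_hasSubgaussianMGF hσ hV)

end SubgaussianSquare

/-! ### Concentration of the sample covariance -/

section SampleCovariance

variable {n : ℕ} {Q : Measure (Fin n → ℝ)} {σ : ℝ} {S : Matrix (Fin n) (Fin n) ℝ}

lemma IsSubGaussianLaw.hasSubgaussianMGF [IsProbabilityMeasure Q] (hQ : IsSubGaussianLaw σ Q)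
    {u : Fin n → ℝ} (hu : u ⬝ᵥ u ≤ 1) :
    HasSubgaussianMGF (fun x => u ⬝ᵥ x) ⟨σ ^ 2, sq_nonneg σ⟩ Q := by
  set r := √(u ⬝ᵥ u)
  have hrr : r * r = u ⬝ᵥ u := Real.mul_self_sqrt (dotProduct_self_nonneg u)
  obtain ⟨Z, hZ, hscale⟩ : ∃ Z : (Fin n → ℝ) → ℝ,
      HasSubgaussianMGF Z ⟨σ ^ 2, sq_nonneg σ⟩ Q ∧ ∀ x, u ⬝ᵥ x = r * Z x := by
    rcases eq_or_ne r 0 with hr | hr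
    · have hu0 : u = 0 := dotProduct_self_eq_zero.1 (by rw [← hrr, hr, mul_zero])
      refine ⟨fun _ => 0, ⟨fun t => by simp, fun t => ?_⟩, fun x => by simp [hu0]⟩
      rw [mgf_const, mul_zero, Real.exp_zero]
      exact Real.one_le_exp (div_nonneg (mul_nonneg (sq_nonneg σ) (sq_nonneg t)) zero_le_two)
    · refine ⟨fun x => (r⁻¹ • u) ⬝ᵥ x, (hQ.2 _ ?_).2, fun x => ?_⟩
      · rw [smul_dotProduct, dotProduct_smul, smul_eq_mul, smul_eq_mul, ← hrr]
        field_simp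
      · change u ⬝ᵥ x = r * ((r⁻¹ • u) ⬝ᵥ x)
        rw [smul_dotProduct, smul_eq_mul, mul_inv_cancel_left₀ hr]
  simp only [hscale]
  refine ⟨fun t => ?_, fun t => ?_⟩
  · simp only [← mul_assoc]
    exact hZ.integrable_exp_mul (t * r)
  · calc mgf (fun x => r * Z x) Q t = mgf Z Q (t * r) := by simp only [mgf, mul_assoc]
      _ ≤ Real.exp (σ ^ 2 * (t * r) ^ 2 / 2) := hZ.mgf_le (t * r)
      _ ≤ Real.exp (σ ^ 2 * t ^ 2 / 2) := by
          have hsq : (t * r) ^ 2 ≤ t ^ 2 := by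
            rw [mul_pow, sq r, hrr]
            exact mul_le_of_le_one_right (sq_nonneg t) hu
          gcongr

lemma IsSubGaussianLaw.integral_mul [IsProbabilityMeasure Q] (hQ : IsSubGaussianLaw σ Q)
    (hS : ∀ a b, cov[fun x => x a, fun x => x b; Q] = S a b) (u v : Fin n → ℝ) :
    ∫ x, (u ⬝ᵥ x) * (v ⬝ᵥ x) ∂Q = u ⬝ᵥ (S *ᵥ v) := by
  have hmem (a : Fin n) : MemLp (fun x : Fin n → ℝ => x a) 2 Q := by
    simpa using (hQ.hasSubgaussianMGF (u := Pi.single a 1) (by simp)).memLp 2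
  have hint (a b : Fin n) : Integrable (fun x : Fin n → ℝ => u a * v b * (x a * x b)) Q :=
    ((hmem a).integrable_mul (hmem b)).const_mul _
  have hcov (a b : Fin n) : ∫ x, x a * x b ∂Q = S a b := by
    simp [← hS a b, covariance, hQ.1]
  calc ∫ x, (u ⬝ᵥ x) * (v ⬝ᵥ x) ∂Q
      = ∫ x, ∑ a, ∑ b, u a * v b * (x a * x b) ∂Q := by
        simp only [dotProduct, Finset.sum_mul_sum]
        simp only [mul_mul_mul_comm]
    _ = ∑ a, ∑ b, u a * v b * S a b := by
        rw [integral_finsetSum _ fun a _ => integrable_finsetSum _ fun b _ => hint a b]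
        simp only [integral_finsetSum _ fun b _ => hint _ b, integral_const_mul, hcov]
    _ = u ⬝ᵥ (S *ᵥ v) := by
        simp only [dotProduct, mulVec, Finset.mul_sum]
        exact Finset.sum_congr rfl fun a _ => Finset.sum_congr rfl fun b _ => by ring

variable {N : ℕ}

lemma sum_dotProduct_mul_sub_eq (hN : 0 < N) (A : Matrix (Fin N) (Fin n) ℝ) (u v : Fin n → ℝ)
    (c : ℝ) :
    ∑ i, ((u ⬝ᵥ A i) * (v ⬝ᵥ A i) - c) = N * (u ⬝ᵥ (sampleCov A *ᵥ v) - c) := by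
  have hN' : (N : ℝ) ≠ 0 := by exact_mod_cast hN.ne'
  rw [dotProduct_sampleCov_mulVec, mul_sub, ← mul_assoc, mul_one_div_cancel hN', one_mul,
    Finset.sum_sub_distrib, Finset.sum_const, Finset.card_univ, Fintype.card_fin, nsmul_eq_mul]
  simp only [dotProduct_comm u (A _), dotProduct_comm v (A _)]
  rfl

variable {Ω : Type*} [MeasurableSpace Ω] {P : Measure Ω} {X : Ω → Matrix (Fin N) (Fin n) ℝ}

lemma IsRowwiseSubGaussian.measureReal_lt_abs_le (hX : IsRowwiseSubGaussian P X σ S)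
    (hσ : 0 < σ) (hN : 0 < N) {u v : Fin n → ℝ} (hu : u ⬝ᵥ u ≤ 1) (hv : v ⬝ᵥ v ≤ 1) {a b : ℝ}
    (ha : a = 1 / (6 * σ ^ 2)) (hb0 : 0 ≤ b) (hb : b ≤ 64 / a) :
    P.real {ω | b < |u ⬝ᵥ (sampleCov (X ω) *ᵥ v) - u ⬝ᵥ (S *ᵥ v)|}
      ≤ 2 * Real.exp (-(N * (a ^ 2 / 256 * b ^ 2))) := by
  obtain ⟨Q, hQprob, hQ, hS, hlaw, hind⟩ := hX
  have := hind.isProbabilityMeasure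
  have ha0 : 0 < a := by rw [ha]; positivity
  set f : (Fin n → ℝ) → ℝ := fun x => (u ⬝ᵥ x) * (v ⬝ᵥ x)
  have hf : Measurable f := by
    unfold f dotProduct
    fun_prop
  have hproj {z : Fin n → ℝ} (hz : z ⬝ᵥ z ≤ 1) (i : Fin N) :
      HasSubgaussianMGF (fun ω => z ⬝ᵥ X ω i) ⟨σ ^ 2, sq_nonneg σ⟩ P :=
    HasSubgaussianMGF.of_map (X := fun x => z ⬝ᵥ x) (hlaw i).aemeasurable
      ((hlaw i).map_eq ▸ hQ.hasSubgaussianMGF hz)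
  have hsub (i : Fin N) : IsSubexponential a (fun ω => f (X ω i)) P :=
    ha ▸ isSubexponential_mul_of_hasSubgaussianMGF hσ (hproj hu i) (hproj hv i)
  have hmean (i : Fin N) : ∫ ω, f (X ω i) ∂P = u ⬝ᵥ (S *ᵥ v) := by
    rw [← hQ.integral_mul hS]
    exact (hlaw i).integral_comp hf.aestronglyMeasurable
  have hbern := measureReal_le_abs_sum_sub_integral_le (W := fun i ω => f (X ω i)) ha0
    (hind.comp (fun _ => f) fun _ => hf) hsub hb0 hb
  simp only [hmean, Fintype.card_fin] at hbern
  refine (measureReal_mono fun ω (hω : b < _) => ?_).trans hbern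
  change N * b ≤ |∑ i, ((u ⬝ᵥ X ω i) * (v ⬝ᵥ X ω i) - u ⬝ᵥ (S *ᵥ v))|
  rw [sum_dotProduct_mul_sub_eq hN, abs_mul, Nat.abs_cast]
  gcongr

end SampleCovariance

/-! ### Gaussian noise -/

section GaussianNoise

lemma measureReal_le_abs_le_of_hasSubgaussianMGF {Ω : Type*} [MeasurableSpace Ω]
    {P : Measure Ω} [IsFiniteMeasure P] {Y : Ω → ℝ} {c : NNReal} {V : ℝ}
    (hY : HasSubgaussianMGF Y c P) (hV : 0 < V) (hcV : c ≤ V) {b : ℝ} (hb : 0 ≤ b) :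
    P.real {ω | b ≤ |Y ω|} ≤ 2 * Real.exp (-(b ^ 2 / (2 * V))) := by
  have hmgf (t : ℝ) : mgf Y P t ≤ Real.exp (V * t ^ 2 / 2) :=
    (hY.mgf_le t).trans (by gcongr)
  -- The exponent `V t² / 2 - t b` is minimal at `t = b / V`.
  refine (measureReal_le_abs_le_of_mgf_le (t := b / V) (by positivity) (hY.integrable_exp_mul _)
    (hY.integrable_exp_mul _) (hmgf _) ((hmgf _).trans_eq (by rw [neg_sq])) b).trans_eq ?_
  congr 2
  field_simp
  ring

lemma hasSubgaussianMGF_id_gaussianReal (τ : NNReal) :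
    HasSubgaussianMGF (fun x => x) τ (gaussianReal 0 τ) where
  integrable_exp_mul t := integrable_exp_mul_gaussianReal t
  mgf_le t := by
    simp only [mgf_fun_id_gaussianReal, zero_mul, zero_add]
    exact le_rfl

lemma measureReal_pi_gaussianReal_le_abs_dotProduct_le {ι : Type*} [Fintype ι] (τ : NNReal)
    (w : ι → ℝ) {V b : ℝ} (hV : 0 < V) (hτV : τ * (w ⬝ᵥ w) ≤ V) (hb : 0 ≤ b) :
    (Measure.pi fun _ : ι => gaussianReal 0 τ).real {e | b ≤ |w ⬝ᵥ e|}
      ≤ 2 * Real.exp (-(b ^ 2 / (2 * V))) := by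
  have hcoord (i : ι) : HasSubgaussianMGF (fun e : ι → ℝ => w i * e i) (⟨w i ^ 2, sq_nonneg _⟩ * τ)
      (Measure.pi fun _ : ι => gaussianReal 0 τ) := by
    have hmp := measurePreserving_eval (fun _ : ι => gaussianReal 0 τ) i
    exact (HasSubgaussianMGF.of_map hmp.measurable.aemeasurable
      (hmp.map_eq ▸ hasSubgaussianMGF_id_gaussianReal τ)).const_mul (w i)
  have hsum := HasSubgaussianMGF.sum_of_iIndepFun
    (iIndepFun_pi (X := fun i x => w i * x) fun i => by fun_prop) (s := Finset.univ)
    fun i _ => hcoord i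
  refine measureReal_le_abs_le_of_hasSubgaussianMGF hsum hV (le_of_eq_of_le ?_ hτV) hb
  rw [NNReal.coe_sum, dotProduct, Finset.mul_sum]
  refine Finset.sum_congr rfl fun i _ => ?_
  change w i ^ 2 * (τ : ℝ) = τ * (w i * w i)
  ring

end GaussianNoise

/-! ### Conditioning on an independent random variable -/

section Conditioning

variable {Ω α β γ : Type*} [MeasurableSpace Ω] [MeasurableSpace α] [MeasurableSpace β]
  [MeasurableSpace γ] {P : Measure Ω} {X : Ω → α} {Y : Ω → β}

lemma measureReal_mem_le_of_indepFun [IsProbabilityMeasure P] (hX : AEMeasurable X P)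
    (hY : AEMeasurable Y P) (hind : IndepFun X Y P) {B : Set (α × β)} (hB : MeasurableSet B)
    {q : ℝ} (h : ∀ a, (P.map Y).real {b | (a, b) ∈ B} ≤ q) :
    P.real {ω | (X ω, Y ω) ∈ B} ≤ q := by
  have := Measure.isProbabilityMeasure_map hX
  have := Measure.isProbabilityMeasure_map hY
  have : Nonempty α := (nonempty_of_isProbabilityMeasure P).map X
  have hq : 0 ≤ q := measureReal_nonneg.trans (h (Classical.arbitrary α))
  have hslice (a : α) : P.map Y {b | (a, b) ∈ B} ≤ ENNReal.ofReal q := by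
    rw [← ofReal_measureReal]
    exact ENNReal.ofReal_le_ofReal (h a)
  refine ENNReal.toReal_le_of_le_ofReal hq ?_
  calc P {ω | (X ω, Y ω) ∈ B} = P.map (fun ω => (X ω, Y ω)) B :=
        (Measure.map_apply_of_aemeasurable (hX.prodMk hY) hB).symm
    _ = ∫⁻ a, P.map Y {b | (a, b) ∈ B} ∂(P.map X) := by
        rw [(indepFun_iff_map_prod_eq_prod_map_map hX hY).1 hind, Measure.prod_apply hB]
        rfl
    _ ≤ ∫⁻ _, ENNReal.ofReal q ∂(P.map X) := lintegral_mono hslice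
    _ = ENNReal.ofReal q := by rw [lintegral_const, measure_univ, mul_one]

lemma condDistrib_ae_eq_map_of_indepFun [StandardBorelSpace γ] [Nonempty γ] [IsFiniteMeasure P]
    (hX : AEMeasurable X P) (hY : AEMeasurable Y P) (hind : IndepFun X Y P) {g : α × β → γ}
    (hg : Measurable g) :
    ∀ᵐ a ∂(P.map X),
      condDistrib (fun ω => g (X ω, Y ω)) X P a = (P.map Y).map fun b => g (a, b) := by
  set κ : Kernel α γ := (Kernel.id ×ₖ Kernel.const α (P.map Y)).map g
  have hκ (a : α) : κ a = (P.map Y).map fun b => g (a, b) := by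
    rw [Kernel.map_apply _ hg, Kernel.prod_apply, Kernel.id_apply, Kernel.const_apply,
      Measure.dirac_prod, Measure.map_map hg measurable_prodMk_left]
    rfl
  have hgraph : Measurable fun p : α × β => (p.1, g p) := measurable_fst.prodMk hg
  have hjoint : P.map (fun ω => (X ω, g (X ω, Y ω))) = (P.map X) ⊗ₘ κ := by
    have hpush : P.map (fun ω => (X ω, g (X ω, Y ω)))
        = ((P.map X).prod (P.map Y)).map fun p => (p.1, g p) := by
      rw [← (indepFun_iff_map_prod_eq_prod_map_map hX hY).1 hind,
        AEMeasurable.map_map_of_aemeasurable hgraph.aemeasurable (hX.prodMk hY)]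
      rfl
    ext s hs
    rw [hpush, Measure.map_apply hgraph hs, Measure.prod_apply (hgraph hs),
      Measure.compProd_apply hs]
    refine lintegral_congr fun a => ?_
    have hga : Measurable fun b => g (a, b) := hg.comp measurable_prodMk_left
    rw [hκ, Measure.map_apply hga (measurable_prodMk_left hs)]
    rfl
  filter_upwards [condDistrib_ae_eq_of_measure_eq_compProd X
    (hg.comp_aemeasurable (hX.prodMk hY)) hjoint] with a ha
  exact ha.trans (hκ a)

end Conditioning

/-! ### The conditional law of the leading term -/

section LeadingTerm

lemma map_mulVec_pi_gaussianReal {ι κ : Type*} [Fintype ι] [DecidableEq ι] [Fintype κ]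
    (τ : NNReal) (B : Matrix ι κ ℝ) :
    (Measure.pi fun _ : κ => gaussianReal 0 τ).map (fun e => WithLp.toLp 2 (B *ᵥ e))
      = multivariateGaussian 0 ((τ : ℝ) • (B * Bᵀ)) := by
  have hmeas : Measurable fun e : κ → ℝ => WithLp.toLp 2 (B *ᵥ e) := by
    unfold mulVec dotProduct
    fun_prop
  have hpsd : ((τ : ℝ) • (B * Bᵀ)).PosSemidef := by
    have h := posSemidef_self_mul_conjTranspose B
    rw [conjTranspose_eq_transpose_of_trivial] at h
    exact h.smul τ.2
  have := Measure.isProbabilityMeasure_map (μ := Measure.pi fun _ : κ => gaussianReal 0 τ)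
    hmeas.aemeasurable
  refine Measure.ext_of_charFun (E := EuclideanSpace ℝ ι) ?_
  ext t
  have hadjoint (e : κ → ℝ) : inner ℝ (WithLp.toLp 2 (B *ᵥ e)) t
      = inner ℝ (WithLp.toLp 2 e) (WithLp.toLp 2 (Bᵀ *ᵥ t.ofLp)) := by
    simp only [EuclideanSpace.inner_eq_star_dotProduct, star_trivial, dotProduct_mulVec,
      mulVec_transpose]
  have hpull : charFun ((Measure.pi fun _ : κ => gaussianReal 0 τ).map
      (fun e => WithLp.toLp 2 (B *ᵥ e))) t
      = charFun ((Measure.pi fun _ : κ => gaussianReal 0 τ).map (WithLp.toLp 2))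
        (WithLp.toLp 2 (Bᵀ *ᵥ t.ofLp)) := by
    rw [charFun_apply, charFun_apply, integral_map hmeas.aemeasurable
      (Measurable.aestronglyMeasurable (by fun_prop)), integral_map (by fun_prop)
      (Measurable.aestronglyMeasurable (by fun_prop))]
    simp only [hadjoint]
  have hquad : t.ofLp ⬝ᵥ (((τ : ℝ) • (B * Bᵀ)) *ᵥ t.ofLp) = τ * ∑ i, (Bᵀ *ᵥ t.ofLp) i ^ 2 := by
    rw [smul_mulVec, dotProduct_smul, smul_eq_mul, ← mulVec_mulVec, dotProduct_mulVec,
      ← mulVec_transpose]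
    simp only [dotProduct, sq]
  rw [charFun_multivariateGaussian hpsd, hpull, charFun_pi, hquad]
  simp only [charFun_gaussianReal]
  rw [← Complex.exp_sum]
  congr 1
  push_cast
  simp [Finset.mul_sum, Finset.sum_div, mul_comm]

variable {N n : ℕ}

lemma map_leadingTerm_pi_gaussianReal (τ : NNReal) (A : Matrix (Fin N) (Fin n) ℝ)
    (Θ : Matrix (Fin n) (Fin n) ℝ) :
    (Measure.pi fun _ : Fin N => gaussianReal 0 τ).map
        (fun e => WithLp.toLp 2 (leadingTerm A Θ e))
      = multivariateGaussian 0 ((τ : ℝ) • (Θ * sampleCov A * Θᵀ)) := by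
  simp only [leadingTerm, ← smul_mulVec]
  rw [map_mulVec_pi_gaussianReal]
  congr 2
  rw [transpose_smul, Matrix.smul_mul, Matrix.mul_smul, smul_smul, transpose_mul,
    transpose_transpose, sampleCov, Matrix.mul_smul, Matrix.smul_mul, div_mul_div_comm,
    Real.mul_self_sqrt (Nat.cast_nonneg N), one_mul]
  simp only [Matrix.mul_assoc]

lemma measurable_leadingTerm {T : Matrix (Fin N) (Fin n) ℝ → Matrix (Fin n) (Fin n) ℝ}
    (hT : Measurable T) :
    Measurable fun p : Matrix (Fin N) (Fin n) ℝ × (Fin N → ℝ) =>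
      WithLp.toLp 2 (leadingTerm p.1 (T p.1) p.2) := by
  have hT' (i j : Fin n) :
      Measurable fun p : Matrix (Fin N) (Fin n) ℝ × (Fin N → ℝ) => T p.1 i j :=
    measurable_pi_iff.1 (measurable_pi_iff.1 (hT.comp measurable_fst) i) j
  have hA (i : Fin N) (j : Fin n) :
      Measurable fun p : Matrix (Fin N) (Fin n) ℝ × (Fin N → ℝ) => p.1 i j :=
    measurable_pi_iff.1 (measurable_pi_iff.1 measurable_fst i) j
  refine (PiLp.continuous_toLp 2 _).measurable.comp (measurable_pi_iff.2 fun i => ?_)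
  simp only [leadingTerm, Pi.smul_apply, mulVec, dotProduct, mul_apply, transpose_apply,
    smul_eq_mul]
  refine Measurable.const_mul (Finset.measurable_sum _ fun r _ => ?_) _
  exact (Finset.measurable_sum _ fun l _ => (hT' i l).mul (hA r l)).mul
    ((measurable_pi_apply r).comp measurable_snd)

lemma condDistrib_leadingTerm {Ω : Type*} [MeasurableSpace Ω] {P : Measure Ω}
    [IsFiniteMeasure P] {X : Ω → Matrix (Fin N) (Fin n) ℝ} {ε : Ω → Fin N → ℝ} {τ : NNReal}
    (hX : AEMeasurable X P) (hε : HasLaw ε (Measure.pi fun _ : Fin N => gaussianReal 0 τ) P)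
    (hind : IndepFun X ε P) {T : Matrix (Fin N) (Fin n) ℝ → Matrix (Fin n) (Fin n) ℝ}
    (hT : Measurable T) :
    ∀ᵐ A ∂(P.map X),
      condDistrib (fun ω => WithLp.toLp 2 (leadingTerm (X ω) (T (X ω)) (ε ω))) X P A
        = multivariateGaussian 0 ((τ : ℝ) • (T A * sampleCov A * (T A)ᵀ)) := by
  filter_upwards [condDistrib_ae_eq_map_of_indepFun hX hε.aemeasurable hind
    (measurable_leadingTerm hT)] with A hA
  rw [hA, hε.map_eq, map_leadingTerm_pi_gaussianReal]

end LeadingTerm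

/-! ### Symmetric matrices with bounded eigenvalues -/

section Spectral

variable {n : ℕ} {S : Matrix (Fin n) (Fin n) ℝ} {lo hi : ℝ}

lemma SymmEigenvaluesIn.isSymm (h : SymmEigenvaluesIn lo hi S) : S.IsSymm := by
  obtain ⟨h, -⟩ := h
  rwa [IsHermitian, conjTranspose_eq_transpose_of_trivial] at h

lemma SymmEigenvaluesIn.quadForm_mem_Icc (h : SymmEigenvaluesIn lo hi S) (v : Fin n → ℝ) :
    v ⬝ᵥ (S *ᵥ v) ∈ Set.Icc (lo * (v ⬝ᵥ v)) (hi * (v ⬝ᵥ v)) := by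
  have hsymm : Sᵀ = S := h.isSymm
  obtain ⟨h, hbound⟩ := h
  set w : Fin n → Fin n → ℝ := fun i => (h.eigenvectorBasis i).ofLp
  have hparseval (x y : Fin n → ℝ) : x ⬝ᵥ y = ∑ i, (w i ⬝ᵥ x) * (w i ⬝ᵥ y) := by
    have hsum := h.eigenvectorBasis.sum_inner_mul_inner (WithLp.toLp 2 x) (WithLp.toLp 2 y)
    simp only [EuclideanSpace.inner_eq_star_dotProduct, star_trivial] at hsum
    rw [dotProduct_comm x y, ← hsum]
    exact Finset.sum_congr rfl fun i _ => by rw [dotProduct_comm y]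
  have heigen (i : Fin n) : w i ⬝ᵥ (S *ᵥ v) = h.eigenvalues i * (w i ⬝ᵥ v) := by
    rw [dotProduct_mulVec, ← mulVec_transpose, hsymm, h.mulVec_eigenvectorBasis i,
      smul_dotProduct, smul_eq_mul]
  have hdiag : v ⬝ᵥ (S *ᵥ v) = ∑ i, h.eigenvalues i * (w i ⬝ᵥ v) ^ 2 := by
    rw [hparseval v (S *ᵥ v)]
    exact Finset.sum_congr rfl fun i _ => by rw [heigen]; ring
  have hnorm : v ⬝ᵥ v = ∑ i, (w i ⬝ᵥ v) ^ 2 := by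
    rw [hparseval v v]
    simp only [sq]
  rw [hdiag, hnorm, Finset.mul_sum, Finset.mul_sum]
  constructor
  · gcongr with i
    exact (hbound i).1
  · gcongr with i
    exact (hbound i).2

lemma SymmEigenvaluesIn.isUnit_det (h : SymmEigenvaluesIn lo hi S) (hlo : 0 < lo) :
    IsUnit S.det := by
  rw [← isUnit_iff_isUnit_det, ← mulVec_injective_iff_isUnit]
  intro x y hxy
  have hker : S *ᵥ (x - y) = 0 := by rw [mulVec_sub, sub_eq_zero.2 hxy]
  have hle := (h.quadForm_mem_Icc (x - y)).1
  rw [hker, dotProduct_zero] at hle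
  have hzero : (x - y) ⬝ᵥ (x - y) = 0 :=
    le_antisymm (nonpos_of_mul_nonpos_right hle hlo) (dotProduct_self_nonneg (x - y))
  exact sub_eq_zero.1 (dotProduct_self_eq_zero.1 hzero)

lemma SymmEigenvaluesIn.inv_apply_dotProduct_mulVec (h : SymmEigenvaluesIn lo hi S)
    (hlo : 0 < lo) (i : Fin n) (v : Fin n → ℝ) : S⁻¹ i ⬝ᵥ (S *ᵥ v) = v i := by
  change (S⁻¹ *ᵥ (S *ᵥ v)) i = v i
  rw [mulVec_mulVec, nonsing_inv_mul _ (h.isUnit_det hlo), one_mulVec]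

lemma SymmEigenvaluesIn.smul_inv_apply_dotProduct_self_le_one (h : SymmEigenvaluesIn lo hi S)
    (hlo : 0 < lo) (i : Fin n) : (lo • S⁻¹ i) ⬝ᵥ (lo • S⁻¹ i) ≤ 1 := by
  set u := S⁻¹ i with hu
  set q := u ⬝ᵥ u
  have hcoord : u i ^ 2 ≤ q := by
    rw [sq]
    exact Finset.single_le_sum (f := fun j => u j * u j) (fun j _ => mul_self_nonneg (u j))
      (Finset.mem_univ i)
  have hlower : lo * q ≤ u i := by
    have h1 := (h.quadForm_mem_Icc u).1
    rwa [hu, h.inv_apply_dotProduct_mulVec hlo i, ← hu] at h1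
  have hq : 0 ≤ q := dotProduct_self_nonneg u
  rw [smul_dotProduct, dotProduct_smul, smul_eq_mul, smul_eq_mul]
  rcases hq.eq_or_lt with hq0 | hq0
  · change lo * (lo * q) ≤ 1
    rw [← hq0, mul_zero, mul_zero]
    exact zero_le_one
  · have hsq : q * (lo * (lo * q)) ≤ q * 1 :=
      calc q * (lo * (lo * q)) = (lo * q) ^ 2 := by ring
        _ ≤ u i ^ 2 := by gcongr
        _ ≤ q * 1 := by rwa [mul_one]
    exact le_of_mul_le_mul_left hsq hq0

end Spectral

/-! ### The good event -/

section UnionBound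

lemma natCast_mul_two_exp_neg_le {n k q : ℕ} {x : ℝ} (hn : 0 < n) (hk : k ≤ n ^ q)
    (hx : (q + 1) * Real.log n ≤ x) : k * (2 * Real.exp (-x)) ≤ 2 / n := by
  have hn0 : (0 : ℝ) < n := by exact_mod_cast hn
  have hexp : Real.exp (-x) ≤ ((n : ℝ) ^ (q + 1))⁻¹ := by
    rw [Real.exp_neg]
    refine inv_anti₀ (by positivity) ?_
    calc (n : ℝ) ^ (q + 1) = Real.exp ((q + 1 : ℕ) * Real.log n) := by
          rw [Real.exp_nat_mul, Real.exp_log hn0]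
      _ ≤ Real.exp x := Real.exp_le_exp.2 (by push_cast; exact hx)
  have hk' : (k : ℝ) ≤ (n : ℝ) ^ q := by exact_mod_cast hk
  calc k * (2 * Real.exp (-x)) ≤ (n : ℝ) ^ q * (2 * ((n : ℝ) ^ (q + 1))⁻¹) := by gcongr
    _ = 2 / n := by rw [pow_succ]; field_simp

lemma measureReal_exists_le {Ω ι : Type*} [MeasurableSpace Ω] [Fintype ι] {P : Measure Ω}
    {p : ι → Ω → Prop} {n q : ℕ} {x : ℝ} (hn : 0 < n) (hcard : Fintype.card ι ≤ n ^ q)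
    (hx : (q + 1) * Real.log n ≤ x)
    (h : ∀ i, P.real {ω | p i ω} ≤ 2 * Real.exp (-x)) :
    P.real {ω | ∃ i, p i ω} ≤ 2 / n := by
  rw [Set.ofPred_exists]
  calc P.real (⋃ i, {ω | p i ω}) ≤ ∑ i, P.real {ω | p i ω} := measureReal_iUnion_fintype_le _
    _ ≤ Fintype.card ι * (2 * Real.exp (-x)) := by
        simpa using Finset.sum_le_sum fun i (_ : i ∈ Finset.univ) => h i
    _ ≤ 2 / n := natCast_mul_two_exp_neg_le hn hcard hx

end UnionBound

section GoodEvent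

variable {Ω : Type*} [MeasurableSpace Ω] {P : Measure Ω} {N n : ℕ}
  {X : Ω → Matrix (Fin N) (Fin n) ℝ} {S : Matrix (Fin n) (Fin n) ℝ} {σx lo hi a : ℝ}

lemma IsRowwiseSubGaussian.aemeasurable (hX : IsRowwiseSubGaussian P X σx S) :
    AEMeasurable X P := by
  obtain ⟨Q, _, -, -, hrows, hind⟩ := hX
  exact (iIndepFun.hasLaw_pi hrows hind).aemeasurable

section Design

variable [IsFiniteMeasure P]

lemma IsRowwiseSubGaussian.measureReal_not_cLIMEFeasible_inv_le
    (hX : IsRowwiseSubGaussian P X σx S) (hσx : 0 < σx) (hS : SymmEigenvaluesIn lo hi S)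
    (hlo : 0 < lo) (ha : a = 1 / (6 * σx ^ 2)) (hn : 0 < n) (hN : 0 < N)
    (hnN : Real.log n ≤ N) :
    P.real {ω | ¬ CLIMEFeasible (28 / (a * lo) * √(Real.log n / N)) (sampleCov (X ω)) S⁻¹}
      ≤ 2 / n := by
  have ha0 : 0 < a := by rw [ha]; positivity
  have hN0 : (0 : ℝ) < N := by exact_mod_cast hN
  have hlog : 0 ≤ Real.log n := Real.log_natCast_nonneg n
  set t : ℝ := √(Real.log n / N)
  have ht : t ^ 2 = Real.log n / N := Real.sq_sqrt (by positivity)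
  have ht1 : t ≤ 1 := Real.sqrt_le_one.2 ((div_le_one hN0).2 hnN)
  have hunion : P.real {ω | ∃ p : Fin n × Fin n,
      28 / (a * lo) * t < |(S⁻¹ * sampleCov (X ω) - 1) p.1 p.2|} ≤ 2 / n := by
    refine measureReal_exists_le (q := 2) (x := N * (a ^ 2 / 256 * (28 / a * t) ^ 2)) hn
      (by simp [sq]) ?_ fun p => ?_
    · have hx : N * (a ^ 2 / 256 * (28 / a * t) ^ 2) = 49 / 16 * Real.log n := by
        rw [mul_pow, ht]
        field_simp
        ring
      rw [hx]
      push_cast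
      linarith
    have hbilin (Γ : Matrix (Fin n) (Fin n) ℝ) :
        (lo • S⁻¹ p.1) ⬝ᵥ (Γ *ᵥ Pi.single p.2 1) - (lo • S⁻¹ p.1) ⬝ᵥ (S *ᵥ Pi.single p.2 1)
          = lo * (S⁻¹ * Γ - 1) p.1 p.2 := by
      rw [smul_dotProduct, smul_dotProduct, hS.inv_apply_dotProduct_mulVec hlo,
        Matrix.sub_apply, mulVec_single_one, one_apply, Pi.single_apply, smul_eq_mul, smul_eq_mul,
        mul_sub]
      rfl
    refine (measureReal_mono fun ω hω => ?_).trans (hX.measureReal_lt_abs_le hσx hN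
      (hS.smul_inv_apply_dotProduct_self_le_one hlo p.1) (v := Pi.single p.2 1) (by simp) ha
      (b := 28 / a * t) (by positivity) ?_)
    · change 28 / (a * lo) * t < |(S⁻¹ * sampleCov (X ω) - 1) p.1 p.2| at hω
      change 28 / a * t < |_|
      rw [hbilin, abs_mul, abs_of_pos hlo]
      calc 28 / a * t = lo * (28 / (a * lo) * t) := by field_simp
        _ < lo * |(S⁻¹ * sampleCov (X ω) - 1) p.1 p.2| := mul_lt_mul_of_pos_left hω hlo
    · calc 28 / a * t ≤ 28 / a * 1 := by gcongr
        _ ≤ 64 / a := by rw [mul_one]; gcongr; norm_num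
  refine (measureReal_mono fun ω (hω : ¬ _) => ?_).trans hunion
  by_contra hcon
  exact hω (matSupNorm_le (by positivity) fun i j => not_lt.1 fun h => hcon ⟨(i, j), h⟩)

lemma IsRowwiseSubGaussian.measureReal_lt_sampleCov_diag_le (hX : IsRowwiseSubGaussian P X σx S)
    (hσx : 0 < σx) (hS : SymmEigenvaluesIn lo hi S) (ha : a = 1 / (6 * σx ^ 2)) (hn : 0 < n)
    (hN : 0 < N) (hnN : Real.log n ≤ N) :
    P.real {ω | ∃ l, hi + 64 / a < sampleCov (X ω) l l} ≤ 2 / n := by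
  have ha0 : 0 < a := by rw [ha]; positivity
  refine measureReal_exists_le (q := 1) (x := N * (a ^ 2 / 256 * (64 / a) ^ 2)) hn (by simp)
    ?_ fun l => ?_
  · have hx : N * (a ^ 2 / 256 * (64 / a) ^ 2) = 16 * N := by
      field_simp
      norm_num
    rw [hx]
    push_cast
    linarith [Nat.cast_nonneg (α := ℝ) N]
  refine (measureReal_mono fun ω hω => ?_).trans (hX.measureReal_lt_abs_le hσx hN
    (u := Pi.single l 1) (v := Pi.single l 1) (by simp) (by simp) ha (b := 64 / a) (by positivity)
    le_rfl)
  change hi + 64 / a < sampleCov (X ω) l l at hω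
  have hdiag (Γ : Matrix (Fin n) (Fin n) ℝ) : Pi.single l 1 ⬝ᵥ (Γ *ᵥ Pi.single l 1) = Γ l l := by
    simp
  have hSl := (hS.quadForm_mem_Icc (Pi.single l 1)).2
  rw [hdiag, single_one_dotProduct, Pi.single_eq_same, mul_one] at hSl
  change 64 / a < |_|
  rw [hdiag, hdiag]
  exact lt_of_lt_of_le (by linarith) (le_abs_self _)

lemma IsRowwiseSubGaussian.measureReal_quadForm_lt_le (hX : IsRowwiseSubGaussian P X σx S)
    (hσx : 0 < σx) (hS : SymmEigenvaluesIn lo hi S) (ha : a = 1 / (6 * σx ^ 2)) (hN : 0 < N)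
    {b : ℝ} (hb : 0 ≤ b) (hba : b ≤ 64 / a) (z : Fin n → ℝ) :
    P.real {ω | z ⬝ᵥ (sampleCov (X ω) *ᵥ z) < (lo - b) * (z ⬝ᵥ z)}
      ≤ 2 * Real.exp (-(N * (a ^ 2 / 256 * b ^ 2))) := by
  rcases eq_or_ne z 0 with rfl | hz
  · simp only [zero_dotProduct, mul_zero, lt_irrefl, Set.ofPred_false, measureReal_empty]
    positivity
  set r := √(z ⬝ᵥ z)
  have hr0 : 0 < r := Real.sqrt_pos.2
    ((dotProduct_self_nonneg z).lt_of_ne fun h => hz (dotProduct_self_eq_zero.1 h.symm))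
  have hr : r ^ 2 = z ⬝ᵥ z := Real.sq_sqrt (dotProduct_self_nonneg z)
  have hquad (Γ : Matrix (Fin n) (Fin n) ℝ) :
      (r⁻¹ • z) ⬝ᵥ (Γ *ᵥ (r⁻¹ • z)) = (z ⬝ᵥ (Γ *ᵥ z)) / r ^ 2 := by
    rw [mulVec_smul, smul_dotProduct, dotProduct_smul, smul_eq_mul, smul_eq_mul]
    field_simp
  have hunit : (r⁻¹ • z) ⬝ᵥ (r⁻¹ • z) ≤ 1 := by
    have h := hquad 1
    rw [one_mulVec, one_mulVec, ← hr, div_self (by positivity)] at h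
    exact h.le
  refine (measureReal_mono fun ω hω => ?_).trans
    (hX.measureReal_lt_abs_le hσx hN hunit hunit ha hb hba)
  change z ⬝ᵥ (sampleCov (X ω) *ᵥ z) < (lo - b) * (z ⬝ᵥ z) at hω
  have hSz := (hS.quadForm_mem_Icc z).1
  change b < |_|
  rw [hquad, hquad, abs_sub_comm, ← sub_div]
  refine lt_of_lt_of_le ?_ (le_abs_self _)
  rw [lt_div_iff₀ (by positivity), hr]
  linarith

lemma IsRowwiseSubGaussian.measureReal_exists_signedSum_lt_le
    (hX : IsRowwiseSubGaussian P X σx S) (hσx : 0 < σx) (hS : SymmEigenvaluesIn lo hi S)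
    (ha : a = 1 / (6 * σx ^ 2)) (hn : 2 ≤ n) (hN : 0 < N) {b : ℝ} (hb : 0 ≤ b)
    (hba : b ≤ 64 / a) {r : ℕ}
    (hr : (2 * r + 1) * Real.log n ≤ N * (a ^ 2 / 256 * b ^ 2)) :
    P.real {ω | ∃ f : Fin r → Fin n × ℤˣ, signedSum f ⬝ᵥ (sampleCov (X ω) *ᵥ signedSum f)
      < (lo - b) * (signedSum f ⬝ᵥ signedSum f)} ≤ 2 / n := by
  refine measureReal_exists_le (q := 2 * r) (by omega) ?_ (by exact_mod_cast hr)
    fun f => hX.measureReal_quadForm_lt_le hσx hS ha hN hb hba (signedSum f)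
  calc Fintype.card (Fin r → Fin n × ℤˣ) = (n * 2) ^ r := by simp
    _ ≤ (n ^ 2) ^ r := by
        rw [sq]
        exact Nat.pow_le_pow_left (Nat.mul_le_mul_left n hn) r
    _ = n ^ (2 * r) := (pow_mul n 2 r).symm

end Design

section Noise

variable {ε : Ω → Fin N → ℝ} {τ : NNReal}

lemma transpose_dotProduct_self (hN : 0 < N) (A : Matrix (Fin N) (Fin n) ℝ) (l : Fin n) :
    Aᵀ l ⬝ᵥ Aᵀ l = N * sampleCov A l l := by
  have hN0 : (N : ℝ) ≠ 0 := by exact_mod_cast hN.ne'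
  rw [sampleCov, Matrix.smul_apply, smul_eq_mul, ← mul_assoc, mul_one_div_cancel hN0, one_mul]
  rfl

lemma measureReal_lt_abs_transpose_mulVec_le [IsProbabilityMeasure P] (hX : AEMeasurable X P)
    (hε : HasLaw ε (Measure.pi fun _ : Fin N => gaussianReal 0 τ) P) (hind : IndepFun X ε P)
    (hτ : 0 < τ) (hN : 0 < N) {D b : ℝ} (hD : 0 < D) (hb : 0 ≤ b) (l : Fin n) :
    P.real {ω | sampleCov (X ω) l l ≤ D ∧ b < |((X ω)ᵀ *ᵥ ε ω) l|}
      ≤ 2 * Real.exp (-(b ^ 2 / (2 * (τ * (N * D))))) := by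
  have hmeas : MeasurableSet {p : Matrix (Fin N) (Fin n) ℝ × (Fin N → ℝ) |
      sampleCov p.1 l l ≤ D ∧ b < |(p.1ᵀ *ᵥ p.2) l|} := by
    have (i : Fin N) (j : Fin n) :
        Measurable fun p : Matrix (Fin N) (Fin n) ℝ × (Fin N → ℝ) => p.1 i j :=
      measurable_pi_iff.1 (measurable_pi_iff.1 measurable_fst i) j
    have hcov : Measurable fun p : Matrix (Fin N) (Fin n) ℝ × (Fin N → ℝ) =>
        sampleCov p.1 l l := by
      simp only [sampleCov, Matrix.smul_apply, mul_apply, transpose_apply, smul_eq_mul]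
      fun_prop
    have hnoise : Measurable fun p : Matrix (Fin N) (Fin n) ℝ × (Fin N → ℝ) =>
        (p.1ᵀ *ᵥ p.2) l := by
      simp only [mulVec, dotProduct, transpose_apply]
      fun_prop
    exact (measurableSet_le hcov measurable_const).inter
      (measurableSet_lt measurable_const hnoise.abs)
  refine measureReal_mem_le_of_indepFun hX hε.aemeasurable hind hmeas fun A => ?_
  rw [hε.map_eq]
  by_cases hA : sampleCov A l l ≤ D
  · refine (measureReal_mono fun e he => ?_).trans
      (measureReal_pi_gaussianReal_le_abs_dotProduct_le τ (Aᵀ l) (by positivity) ?_ hb)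
    · exact he.2.le
    · rw [transpose_dotProduct_self hN]
      gcongr
  · simp only [Set.mem_ofPred_eq, hA, false_and, Set.ofPred_false, measureReal_empty]
    positivity

lemma measureReal_exists_lt_abs_transpose_mulVec_le [IsProbabilityMeasure P]
    (hX : AEMeasurable X P) (hε : HasLaw ε (Measure.pi fun _ : Fin N => gaussianReal 0 τ) P)
    (hind : IndepFun X ε P) {D lam σ : ℝ} (hτ : τ = σ ^ 2) (hσ : 0 < σ) (hn : 0 < n)
    (hN : 0 < N) (hD : 0 < D) (hlam : 4 * √D * (σ * √(Real.log n / N)) ≤ lam) :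
    P.real {ω | ∃ l, sampleCov (X ω) l l ≤ D ∧ N * (lam / 2) < |((X ω)ᵀ *ᵥ ε ω) l|}
      ≤ 2 / n := by
  have : (0 : ℝ) < N := by exact_mod_cast hN
  have : 0 ≤ Real.log n := Real.log_natCast_nonneg n
  have hlam0 : 0 ≤ lam := le_trans (by positivity) hlam
  have hτ0 : 0 < τ := by
    rw [← NNReal.coe_pos, hτ]
    positivity
  refine measureReal_exists_le (q := 1) hn (by simp) ?_ fun l =>
    measureReal_lt_abs_transpose_mulVec_le hX hε hind hτ0 hN hD (by positivity) l
  have hlamsq : 16 * D * σ ^ 2 * (Real.log n / N) ≤ lam ^ 2 :=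
    calc 16 * D * σ ^ 2 * (Real.log n / N) = (4 * √D * (σ * √(Real.log n / N))) ^ 2 := by
          rw [mul_pow, mul_pow, mul_pow, Real.sq_sqrt hD.le, Real.sq_sqrt (by positivity)]
          ring
      _ ≤ lam ^ 2 := by gcongr
  rw [hτ, le_div_iff₀ (by positivity)]
  calc (((1 : ℕ) : ℝ) + 1) * Real.log n * (2 * (σ ^ 2 * (N * D)))
      = N ^ 2 / 4 * (16 * D * σ ^ 2 * (Real.log n / N)) := by
        push_cast
        field_simp
        ring
    _ ≤ N ^ 2 / 4 * lam ^ 2 := by gcongr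
    _ = (N * (lam / 2)) ^ 2 := by ring

end Noise

/-- The event on which the estimators are controlled: `S⁻¹` is feasible for the CLIME program,
the sample covariance matrix has restricted eigenvalues, and the tuning parameter of the lasso
dominates the noise. -/
structure GoodEvent (S : Matrix (Fin n) (Fin n) ℝ) (ρ κ r lam : ℝ) (A : Matrix (Fin N) (Fin n) ℝ)
    (e : Fin N → ℝ) : Prop where
  feasible_inv : CLIMEFeasible ρ (sampleCov A) S⁻¹
  restrictedEigenvalue : HasRestrictedEigenvalue κ r (sampleCov A)
  noise_le : ∀ l, |(Aᵀ *ᵥ e) l| ≤ N * (lam / 2)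

lemma measureReal_not_goodEvent_le [IsProbabilityMeasure P] {ε : Ω → Fin N → ℝ} {τ : NNReal}
    {σ b lam r : ℝ} {m : ℕ} (hX : IsRowwiseSubGaussian P X σx S) (hσx : 0 < σx)
    (hS : SymmEigenvaluesIn lo hi S) (hlo : 0 < lo) (hhi : 0 < hi)
    (hε : HasLaw ε (Measure.pi fun _ : Fin N => gaussianReal 0 τ) P) (hind : IndepFun X ε P)
    (hτ : τ = σ ^ 2) (hσ : 0 < σ) (ha : a = 1 / (6 * σx ^ 2)) (hn : 2 ≤ n) (hN : 0 < N)
    (hnN : Real.log n ≤ N) (hb : 0 ≤ b) (hba : b ≤ 64 / a) (hblo : b ≤ lo) (hm : 0 < m)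
    (hmr : 2 * (hi + 64 / a) * r ≤ (lo - b) * m)
    (hmN : (2 * (m + 1 : ℕ) + 1) * Real.log n ≤ N * (a ^ 2 / 256 * b ^ 2))
    (hlam : 4 * √(hi + 64 / a) * (σ * √(Real.log n / N)) ≤ lam) :
    P.real {ω | ¬ GoodEvent S (28 / (a * lo) * √(Real.log n / N)) ((lo - b) / 2) r lam
      (X ω) (ε ω)} ≤ 8 / n := by
  have hn0 : 0 < n := by omega
  have ha0 : 0 < a := by rw [ha]; positivity
  set D : ℝ := hi + 64 / a
  have hD : 0 < D := by positivity
  set E₁ := {ω | ¬ CLIMEFeasible (28 / (a * lo) * √(Real.log n / N)) (sampleCov (X ω)) S⁻¹}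
  set E₂ := {ω | ∃ l, D < sampleCov (X ω) l l}
  set E₃ := {ω | ∃ f : Fin (m + 1) → Fin n × ℤˣ,
    signedSum f ⬝ᵥ (sampleCov (X ω) *ᵥ signedSum f) < (lo - b) * (signedSum f ⬝ᵥ signedSum f)}
  set E₄ := {ω | ∃ l, sampleCov (X ω) l l ≤ D ∧ N * (lam / 2) < |((X ω)ᵀ *ᵥ ε ω) l|}
  have h₁ : P.real E₁ ≤ 2 / n :=
    hX.measureReal_not_cLIMEFeasible_inv_le hσx hS hlo ha hn0 hN hnN
  have h₂ : P.real E₂ ≤ 2 / n := hX.measureReal_lt_sampleCov_diag_le hσx hS ha hn0 hN hnN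
  have h₃ : P.real E₃ ≤ 2 / n :=
    hX.measureReal_exists_signedSum_lt_le hσx hS ha hn hN hb hba hmN
  have h₄ : P.real E₄ ≤ 2 / n := measureReal_exists_lt_abs_transpose_mulVec_le hX.aemeasurable
    hε hind hτ hσ hn0 hN hD hlam
  have hcover (ω : Ω) (h : ω ∉ E₁ ∪ E₂ ∪ E₃ ∪ E₄) :
      GoodEvent S (28 / (a * lo) * √(Real.log n / N)) ((lo - b) / 2) r lam (X ω) (ε ω) := by
    simp only [Set.mem_union, not_or, E₁, E₂, E₃, E₄, Set.mem_ofPred_eq, not_not, not_exists,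
      not_and, not_lt] at h
    obtain ⟨⟨⟨hfeas, hdiag⟩, hquad⟩, hnoise⟩ := h
    exact ⟨hfeas, hasRestrictedEigenvalue_of_signedSum (sub_nonneg.2 hblo) hdiag hD.le hm hmr
      hquad, fun l => hnoise l (hdiag l)⟩
  calc P.real {ω | ¬ GoodEvent S (28 / (a * lo) * √(Real.log n / N)) ((lo - b) / 2) r lam
        (X ω) (ε ω)} ≤ P.real (E₁ ∪ E₂ ∪ E₃ ∪ E₄) :=
        measureReal_mono fun ω hω => by_contra fun h => hω (hcover ω h)
    _ ≤ P.real E₁ + P.real E₂ + P.real E₃ + P.real E₄ := by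
        refine (measureReal_union_le _ _).trans (add_le_add_left ?_ _)
        exact (measureReal_union_le _ _).trans (add_le_add_left (measureReal_union_le _ _) _)
    _ ≤ 2 / n + 2 / n + 2 / n + 2 / n := by gcongr
    _ = 8 / n := by ring

end GoodEvent

lemma exists_measureReal_not_goodEvent_le {σx lo hi : ℝ} (hσx : 0 < σx) (hlo : 0 < lo)
    (hhi : 0 < hi) :
    ∃ C₀ Alam Amu κ : ℝ, 0 < C₀ ∧ 0 < Alam ∧ 0 < Amu ∧ 0 < κ ∧
      ∀ {Ω : Type*} [MeasurableSpace Ω] (P : Measure Ω) [IsProbabilityMeasure P] {N n s : ℕ}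
        {X : Ω → Matrix (Fin N) (Fin n) ℝ} {ε : Ω → Fin N → ℝ}
        {S : Matrix (Fin n) (Fin n) ℝ} {σ lam : ℝ} {τ : NNReal},
        2 ≤ n → 0 < s → C₀ * (s * Real.log n) ≤ N → IsRowwiseSubGaussian P X σx S →
        SymmEigenvaluesIn lo hi S → HasLaw ε (Measure.pi fun _ : Fin N => gaussianReal 0 τ) P →
        IndepFun X ε P → τ = σ ^ 2 → 0 < σ → Alam * (σ * √(Real.log n / N)) ≤ lam →
        P.real {ω | ¬ GoodEvent S (Amu * √(Real.log n / N)) κ (36 * s) lam (X ω) (ε ω)}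
          ≤ 8 / n := by
  obtain ⟨a, ha⟩ : ∃ a, a = 1 / (6 * σx ^ 2) := ⟨_, rfl⟩
  have ha0 : 0 < a := by rw [ha]; positivity
  set D : ℝ := hi + 64 / a
  set b : ℝ := min (lo / 2) (64 / a)
  have hb0 : 0 < b := by positivity
  have hblo : b ≤ lo / 2 := min_le_left _ _
  set w : ℝ := a ^ 2 / 256 * b ^ 2
  have hw : 0 < w := by positivity
  obtain ⟨m, hm⟩ := exists_nat_ge (2 * D * 36 / (lo - b))
  rw [div_le_iff₀ (by linarith)] at hm
  have hm0 : 0 < m := by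
    have : 0 < 2 * D * 36 := by positivity
    exact_mod_cast pos_of_mul_pos_left (this.trans_le hm) (by linarith)
  refine ⟨1 + (2 * (m + 1) + 1) / w, 4 * √D, 28 / (a * lo), (lo - b) / 2, by positivity,
    by positivity, by positivity, by linarith, ?_⟩
  intro Ω _ P _ N n s X ε S σ lam τ hn hs hN hX hS hε hind hτ hσ hlam
  have hlog : 0 < Real.log n := Real.log_pos (by exact_mod_cast hn)
  have hs1 : (1 : ℝ) ≤ s := by exact_mod_cast hs
  rw [one_add_mul] at hN
  have hrest : 0 ≤ (2 * (m + 1) + 1) / w * (s * Real.log n) := by positivity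
  have hnN : Real.log n ≤ N := by linarith [le_mul_of_one_le_left hlog.le hs1]
  refine measureReal_not_goodEvent_le (m := m * s) hX hσx hS hlo hhi hε hind hτ hσ ha hn
    (by exact_mod_cast hlog.trans_le hnN) hnN hb0.le (min_le_right _ _) (by linarith)
    (by positivity) ?_ ?_ hlam
  · calc 2 * D * (36 * s) = 2 * D * 36 * s := by ring
      _ ≤ m * (lo - b) * s := by gcongr
      _ = (lo - b) * (m * s : ℕ) := by push_cast; ring
  · calc (2 * ((m * s + 1 : ℕ) : ℝ) + 1) * Real.log n
        ≤ (2 * (m + 1) + 1) * s * Real.log n := by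
          gcongr
          push_cast
          linarith
      _ = (2 * (m + 1) + 1) / w * (s * Real.log n) * w := by field_simp
      _ ≤ N * w := by
        gcongr
        linarith [mul_pos (zero_lt_one.trans_le hs1) hlog]

/-! ### Rates -/

section Rates

variable {N n : ℕ} {S : Matrix (Fin n) (Fin n) ℝ} {ρ κ lam μ : ℝ} {A : Matrix (Fin N) (Fin n) ℝ}
  {e : Fin N → ℝ} {T : Matrix (Fin N) (Fin n) ℝ → Matrix (Fin n) (Fin n) ℝ}

lemma GoodEvent.cLIMEFeasible_inv {r : ℝ} (h : GoodEvent S ρ κ r lam A e) (hρμ : ρ ≤ μ) :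
    CLIMEFeasible μ (sampleCov A) S⁻¹ :=
  h.feasible_inv.trans hρμ

lemma GoodEvent.isCLIME {r : ℝ} (h : GoodEvent S ρ κ r lam A e) (hρμ : ρ ≤ μ)
    (hT : IsCLIMEEstimator μ T) : IsCLIME μ (sampleCov A) (T A) :=
  hT.2 A ⟨S⁻¹, h.cLIMEFeasible_inv hρμ⟩

lemma GoodEvent.matSupNorm_sub_le {r M B t : ℝ} (h : GoodEvent S ρ κ r lam A e) (hρμ : ρ ≤ μ)
    (hμ : μ ≤ B * t) (hS : S.IsSymm) (hM : opNormInf S⁻¹ ≤ M)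
    (hT : IsCLIMEEstimator μ T) :
    matSupNorm (T A * sampleCov A * (T A)ᵀ - S⁻¹) ≤ 3 * B * (M * t) := by
  have : 0 ≤ M := (opNormInf_nonneg S⁻¹).trans hM
  calc matSupNorm (T A * sampleCov A * (T A)ᵀ - S⁻¹) ≤ 3 * (M * μ) :=
        (h.isCLIME hρμ hT).matSupNorm_sub_le (isSymm_sampleCov A) hS.inv
          (h.cLIMEFeasible_inv hρμ) hM
    _ ≤ 3 * (M * (B * t)) := by gcongr
    _ = 3 * B * (M * t) := by ring

lemma GoodEvent.vecSupNorm_remainderTerm_le {k s₁ s₂ : ℕ} {G : SimpleGraph (Fin n)}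
    {ν σ L Blam Bmu : ℝ} {β b : Fin n → ℝ} (h : GoodEvent S ρ κ (36 * s₂) lam A e)
    (hρμ : ρ ≤ μ) (hμ : μ ≤ Bmu * √(L / N)) (hκ : 0 < κ) (hN : 0 < N) (hL : 0 ≤ L)
    (hT : IsCLIMEEstimator μ T) (hν : 0 ≤ ν) (hνs : ν * s₁ ≤ s₂) (hlam : 0 < lam)
    (hlam' : lam ≤ Blam * (σ * √(L / N))) (hβ : β ∈ paramSpace G k s₁ s₂)
    (hopt : IsGPPLasso G k lam (lam * √(ν / (2 * (maxDeg G : ℝ)) ^ (k + 1))) A (A *ᵥ β + e) b) :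
    vecSupNorm (remainderTerm A (T A) b β)
      ≤ 9 / κ * Bmu * Blam * (σ * s₂ * L / √N) := by
  have : (0 : ℝ) < N := by exact_mod_cast hN
  have hfeas : CLIMEFeasible μ (sampleCov A) (T A) := (h.isCLIME hρμ hT).1
  have hl1 : l1Norm (b - β) ≤ 9 / κ * s₂ * lam :=
    hopt.l1Norm_sub_le hN hν hlam hκ hνs hβ h.noise_le h.restrictedEigenvalue
  have hroot : √(N : ℝ) * (√(L / N) * √(L / N)) = L / √N := by
    rw [Real.mul_self_sqrt (by positivity), ← mul_div_assoc, mul_comm, mul_div_assoc,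
      Real.sqrt_div_self, div_eq_mul_inv]
  calc vecSupNorm (remainderTerm A (T A) b β) ≤ √N * (μ * l1Norm (b - β)) :=
        GraphPPLasso.vecSupNorm_remainderTerm_le hfeas b β
    _ ≤ √N * (Bmu * √(L / N) * (9 / κ * s₂ * (Blam * (σ * √(L / N))))) := by
        have hμ0 : 0 ≤ μ := hfeas.nonneg
        gcongr
        · exact l1Norm_nonneg _
        · exact hμ0.trans hμ
        · exact hl1.trans (by gcongr)
    _ = 9 / κ * Bmu * Blam * (σ * s₂ * (√N * (√(L / N) * √(L / N)))) := by ring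
    _ = 9 / κ * Bmu * Blam * (σ * s₂ * L / √N) := by rw [hroot]; ring

lemma isBigOInProb_of_forall_abs_le {Ω : ℕ → Type*} [∀ j, MeasurableSpace (Ω j)]
    {P : ∀ j, Measure (Ω j)} [∀ j, IsFiniteMeasure (P j)] {Y : ∀ j, Ω j → ℝ} {a : ℕ → ℝ}
    (good : ∀ j, Ω j → Prop)
    (hgood : Tendsto (fun j => (P j).real {ω | ¬ good j ω}) atTop (𝓝 0)) (ha : ∀ j, 0 ≤ a j)
    {C : ℝ} (hY : ∀ᶠ j in atTop, ∀ ω, good j ω → |Y j ω| ≤ C * a j) : IsBigOInProb P Y a := by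
  intro δ hδ
  refine ⟨|C| + 1, by positivity, ?_⟩
  filter_upwards [hgood.eventually_le_const hδ, hY] with j hprob hbound
  rw [← ofReal_measureReal]
  refine ENNReal.ofReal_le_ofReal ((measureReal_mono (s₂ := {ω | ¬ good j ω})
    fun ω hω (hg : good j ω) => ?_).trans hprob)
  have hle : |Y j ω| ≤ (|C| + 1) * a j :=
    (hbound ω hg).trans (mul_le_mul_of_nonneg_right (by linarith [le_abs_self C]) (ha j))
  exact hle.not_gt hω

end Rates

end GraphPPLasso

theorem theorem6_general (σx cLo cHi : ℝ) (hσx : 0 < σx) (hcLo : 0 < cLo) (hcHi : 0 < cHi) :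
    ∃ C₀ Alam Amu : ℝ, 0 < C₀ ∧ 0 < Alam ∧ 0 < Amu ∧
      ∀ (k : ℕ) (ν : ℝ), 0 ≤ ν →
      ∀ (Blam Bmu : ℝ) (N n s₁ s₂ : ℕ → ℕ) (G : ∀ j, SimpleGraph (Fin (n j)))
        (Ω : ℕ → Type*) [∀ j, MeasurableSpace (Ω j)] (P : ∀ j, Measure (Ω j))
        [∀ j, IsProbabilityMeasure (P j)]
        (S : ∀ j, Matrix (Fin (n j)) (Fin (n j)) ℝ) (M σ lam lamg mu : ℕ → ℝ)
        (βstar : ∀ j, Fin (n j) → ℝ)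
        (X : ∀ j, Ω j → Matrix (Fin (N j)) (Fin (n j)) ℝ)
        (ε y : ∀ j, Ω j → Fin (N j) → ℝ)
        (βhat : ∀ j, Ω j → Fin (n j) → ℝ)
        (T : ∀ j, Matrix (Fin (N j)) (Fin (n j)) ℝ → Matrix (Fin (n j)) (Fin (n j)) ℝ),
        Tendsto n atTop atTop →
        (∀ j, C₀ * (s₂ j * Real.log (n j)) ≤ N j) →
        (∀ j, 0 < s₁ j ∧ 0 < s₂ j ∧ ν ≤ (s₂ j : ℝ) / s₁ j) →
        (∀ j, βstar j ∈ GraphPPLasso.paramSpace (G j) k (s₁ j) (s₂ j)) →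
        (∀ j, GraphPPLasso.IsRowwiseSubGaussian (P j) (X j) σx (S j)) →
        (∀ j, GraphPPLasso.SymmEigenvaluesIn cLo cHi (S j)) →
        (∀ j, GraphPPLasso.opNormInf (S j)⁻¹ ≤ M j) →
        (∀ j, 0 < σ j) →
        (∀ j, HasLaw (ε j)
          (Measure.pi fun _ : Fin (N j) => gaussianReal 0 ⟨σ j ^ 2, sq_nonneg (σ j)⟩) (P j)) →
        (∀ j, IndepFun (X j) (ε j) (P j)) →
        (∀ j ω, y j ω = X j ω *ᵥ βstar j + ε j ω) →
        (∀ j, Alam * (σ j * √(Real.log (n j) / N j)) ≤ lam j ∧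
          lam j ≤ Blam * (σ j * √(Real.log (n j) / N j))) →
        (∀ j, lamg j = lam j * √(ν / (2 * (GraphPPLasso.maxDeg (G j) : ℝ)) ^ (k + 1))) →
        (∀ j, Amu * √(Real.log (n j) / N j) ≤ mu j ∧
          mu j ≤ Bmu * √(Real.log (n j) / N j)) →
        (∀ j ω, GraphPPLasso.IsGPPLasso (G j) k (lam j) (lamg j) (X j ω) (y j ω) (βhat j ω)) →
        (∀ j, GraphPPLasso.IsCLIMEEstimator (mu j) (T j)) →
        (∀ j ω, √(N j : ℝ) •
            (GraphPPLasso.oneStep (X j ω) (y j ω) (T j (X j ω)) (βhat j ω) - βstar j)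
          = GraphPPLasso.leadingTerm (X j ω) (T j (X j ω)) (ε j ω)
            - GraphPPLasso.remainderTerm (X j ω) (T j (X j ω)) (βhat j ω) (βstar j)) ∧
        (∀ j, ∀ᵐ A ∂((P j).map (X j)),
          condDistrib
              (fun ω => WithLp.toLp 2
                (GraphPPLasso.leadingTerm (X j ω) (T j (X j ω)) (ε j ω)))
              (X j) (P j) A
            = multivariateGaussian 0
                (σ j ^ 2 • (T j A * GraphPPLasso.sampleCov A * (T j A)ᵀ))) ∧
        GraphPPLasso.IsBigOInProb P
          (fun j ω => GraphPPLasso.vecSupNorm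
            (GraphPPLasso.remainderTerm (X j ω) (T j (X j ω)) (βhat j ω) (βstar j)))
          (fun j => σ j * s₂ j * Real.log (n j) / √(N j : ℝ)) ∧
        GraphPPLasso.IsBigOInProb P
          (fun j ω => GraphPPLasso.matSupNorm
            (T j (X j ω) * GraphPPLasso.sampleCov (X j ω) * (T j (X j ω))ᵀ - (S j)⁻¹))
          (fun j => M j * √(Real.log (n j) / N j)) := by
  obtain ⟨C₀, Alam, Amu, κ, hC₀, hAlam, hAmu, hκ, hprob⟩ :=
    GraphPPLasso.exists_measureReal_not_goodEvent_le hσx hcLo hcHi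
  refine ⟨C₀, Alam, Amu, hC₀, hAlam, hAmu, ?_⟩
  intro k ν hν Blam Bmu N n s₁ s₂ G Ω _ P _ S M σ lam lamg mu βstar X ε y βhat T
    hn hN hs hβ hX hS hM hσ hε hind hy hlam hlamg hmu hopt hT
  have hgood : Tendsto (fun j => (P j).real {ω | ¬ GraphPPLasso.GoodEvent (S j)
      (Amu * √(Real.log (n j) / N j)) κ (36 * s₂ j) (lam j) (X j ω) (ε j ω)}) atTop (𝓝 0) := by
    refine squeeze_zero' (.of_forall fun j => measureReal_nonneg) ?_
      ((tendsto_const_div_atTop_nhds_zero_nat 8).comp hn)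
    filter_upwards [hn.eventually_ge_atTop 2] with j hj
    exact hprob (P j) hj (hs j).2.1 (hN j) (hX j) (hS j) (hε j) (hind j) rfl (hσ j) (hlam j).1
  have hlog (j) : 0 ≤ Real.log (n j) := Real.log_natCast_nonneg (n j)
  refine ⟨fun j ω => ?_, fun j => ?_, ?_, ?_⟩
  · rw [hy]
    exact GraphPPLasso.sqrt_smul_oneStep_sub_eq _ _ _ _ _
  · exact GraphPPLasso.condDistrib_leadingTerm (hX j).aemeasurable (hε j) (hind j) (hT j).1
  · refine GraphPPLasso.isBigOInProb_of_forall_abs_le _ hgood (C := 9 / κ * Bmu * Blam)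
      (fun j => by have := hσ j; have := hlog j; positivity) ?_
    filter_upwards [hn.eventually_ge_atTop 2] with j hj ω hω
    obtain ⟨hs₁, hs₂, hνs⟩ := hs j
    have hlogpos : 0 < Real.log (n j) := Real.log_pos (by exact_mod_cast hj)
    have hNpos : 0 < (N j : ℝ) := lt_of_lt_of_le (by positivity) (hN j)
    have hlampos : 0 < lam j := lt_of_lt_of_le (by have := hσ j; positivity) (hlam j).1
    rw [abs_of_nonneg (GraphPPLasso.vecSupNorm_nonneg _)]
    exact hω.vecSupNorm_remainderTerm_le (hmu j).1 (hmu j).2 hκ (by exact_mod_cast hNpos)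
      (hlog j) (hT j) hν ((le_div_iff₀ (by positivity)).1 hνs) hlampos (hlam j).2 (hβ j)
      (hlamg j ▸ hy j ω ▸ hopt j ω)
  · refine GraphPPLasso.isBigOInProb_of_forall_abs_le _ hgood (C := 3 * Bmu)
      (fun j => mul_nonneg ((GraphPPLasso.opNormInf_nonneg _).trans (hM j)) (Real.sqrt_nonneg _))
      (.of_forall fun j ω hω => ?_)
    rw [abs_of_nonneg (GraphPPLasso.matSupNorm_nonneg _)]
    exact hω.matSupNorm_sub_le (hmu j).1 (hmu j).2 (hS j).isSymm (hM j) (hT j)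

theorem theorem6
    (k : ℕ) (ν σx cLo cHi : ℝ) (hν0 : 0 ≤ ν) (hν1 : ν < 1) (hσx : 0 < σx)
    (hcLo : 0 < cLo) (hcHi : 0 < cHi) :
    -- thresholds depending only on `k`, `ν`, `σx` and the eigenvalue bounds
    ∃ C₀ Alam Amu : ℝ, 0 < C₀ ∧ 0 < Alam ∧ 0 < Amu ∧
      ∀ (Blam Bmu : ℝ) (N n s₁ s₂ : ℕ → ℕ) (G : ∀ j, SimpleGraph (Fin (n j)))
        (Ω : ℕ → Type*) [∀ j, MeasurableSpace (Ω j)] (P : ∀ j, Measure (Ω j))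
        [∀ j, IsProbabilityMeasure (P j)]
        (S : ∀ j, Matrix (Fin (n j)) (Fin (n j)) ℝ) (M σ lam lamg mu : ℕ → ℝ)
        (βstar : ∀ j, Fin (n j) → ℝ)
        (X : ∀ j, Ω j → Matrix (Fin (N j)) (Fin (n j)) ℝ)
        (ε y : ∀ j, Ω j → Fin (N j) → ℝ)
        (βhat : ∀ j, Ω j → Fin (n j) → ℝ)
        (T : ∀ j, Matrix (Fin (N j)) (Fin (n j)) ℝ → Matrix (Fin (n j)) (Fin (n j)) ℝ),
        -- asymptotic regime
        Tendsto n atTop atTop →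
        (∀ j, C₀ * (s₂ j * Real.log (n j)) ≤ N j) →
        -- true parameter
        (∀ j, 0 < s₁ j ∧ 0 < s₂ j ∧ ν ≤ (s₂ j : ℝ) / s₁ j) →
        (∀ j, βstar j ∈ GraphPPLasso.paramSpace (G j) k (s₁ j) (s₂ j)) →
        -- sub-Gaussian design
        (∀ j, GraphPPLasso.IsRowwiseSubGaussian (P j) (X j) σx (S j)) →
        (∀ j, GraphPPLasso.SymmEigenvaluesIn cLo cHi (S j)) →
        (∀ j, GraphPPLasso.opNormInf (S j)⁻¹ ≤ M j) →
        -- Gaussian noise independent of the design, and the linear model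
        (∀ j, 0 < σ j) →
        (∀ j, HasLaw (ε j)
          (Measure.pi fun _ : Fin (N j) => gaussianReal 0 ⟨σ j ^ 2, sq_nonneg (σ j)⟩) (P j)) →
        (∀ j, IndepFun (X j) (ε j) (P j)) →
        (∀ j ω, y j ω = X j ω *ᵥ βstar j + ε j ω) →
        -- tuning parameters
        (∀ j, Alam * (σ j * √(Real.log (n j) / N j)) ≤ lam j ∧
          lam j ≤ Blam * (σ j * √(Real.log (n j) / N j))) →
        (∀ j, lamg j = lam j * √(ν / (2 * (GraphPPLasso.maxDeg (G j) : ℝ)) ^ (k + 1))) →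
        (∀ j, Amu * √(Real.log (n j) / N j) ≤ mu j ∧
          mu j ≤ Bmu * √(Real.log (n j) / N j)) →
        -- the estimators
        (∀ j ω, GraphPPLasso.IsGPPLasso (G j) k (lam j) (lamg j) (X j ω) (y j ω) (βhat j ω)) →
        (∀ j, GraphPPLasso.IsCLIMEEstimator (mu j) (T j)) →
        -- the decomposition of the one-step estimator
        (∀ j ω, √(N j : ℝ) •
            (GraphPPLasso.oneStep (X j ω) (y j ω) (T j (X j ω)) (βhat j ω) - βstar j)
          = GraphPPLasso.leadingTerm (X j ω) (T j (X j ω)) (ε j ω)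
            - GraphPPLasso.remainderTerm (X j ω) (T j (X j ω)) (βhat j ω) (βstar j)) ∧
        -- the conditional law of the leading term given the design
        (∀ j, ∀ᵐ A ∂((P j).map (X j)),
          condDistrib
              (fun ω => WithLp.toLp 2
                (GraphPPLasso.leadingTerm (X j ω) (T j (X j ω)) (ε j ω)))
              (X j) (P j) A
            = multivariateGaussian 0
                (σ j ^ 2 • (T j A * GraphPPLasso.sampleCov A * (T j A)ᵀ))) ∧
        -- the remainder
        GraphPPLasso.IsBigOInProb P
          (fun j ω => GraphPPLasso.vecSupNorm
            (GraphPPLasso.remainderTerm (X j ω) (T j (X j ω)) (βhat j ω) (βstar j)))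
          (fun j => σ j * s₂ j * Real.log (n j) / √(N j : ℝ)) ∧
        -- the asymptotic covariance
        GraphPPLasso.IsBigOInProb P
          (fun j ω => GraphPPLasso.matSupNorm
            (T j (X j ω) * GraphPPLasso.sampleCov (X j ω) * (T j (X j ω))ᵀ - (S j)⁻¹))
          (fun j => M j * √(Real.log (n j) / N j)) := by
  obtain ⟨C₀, Alam, Amu, hC₀, hAlam, hAmu, h⟩ := theorem6_general σx cLo cHi hσx hcLo hcHi
  exact ⟨C₀, Alam, Amu, hC₀, hAlam, hAmu, h k ν hν0⟩
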